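/- \textbf{Setting.} Let $\Theta=[\underline\theta,\bar\theta]$ with $\underline\theta<\bar\theta$ and $\bar\theta>0$, let $\delta\in(0,1)$, and let $F$ be an absolutely continuous distribution on $\Theta$ with mean $m_\varnothing$ satisfying $\underline\theta<\delta m_\varnothing$. Distributions are identified with their distribution functions. For a distribution $H$ on $\Theta$, let $\mathcal G(H)$ be the set of its mean-preserving contractions, i.e. of distributions $G$ on $\Theta$ with $\int_x^{\bar\theta}G(m)\,dm\ge\int_x^{\bar\theta}H(m)\,dm$ for all $x\in\Theta$, with equality at $x=\underline\theta$. For a distribution $G$ on $\Theta$ let $c_G(x)=\int_x^{\bar\theta}(1-G(m))\,dm$, let $u(G)$ be the unique solution of $u=\int_\Theta\max\{m,\delta u\}\,dG(m)$, and put $r(G)=\delta u(G)$, $\bar u=u(F)$, $\bar r=r(F)$. Let $\xi:\Theta\to\Delta(Z)$ be a signal structure (the public signal); $\xi(dz)$ and $\mathbb E_\xi$ also refer to the marginal law of $z$ when $\theta\sim F$ and $z\sim\xi(\theta)$. Let $F^\xi_z$ be the Bayes posterior of $\theta$ given $z$, a distribution on $\Theta$ assumed atomless for every $z\in Z$. Let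 $G^\varnothing_z$ be the unit mass at $\mathbb E_{F^\xi_z}[\theta]$, let $G^\xi$ be the law of $\mathbb E_{F^\xi_z}[\theta]$ under $\xi(dz)$, and let $r^\xi=r(G^\xi)$. A \emph{stationary equilibrium} consists of continuation values $(U,V)\in\mathbb R^2$ of the agent and the principal and contracts $\langle p_z,G_z\rangle\in\mathbb R_+\times\mathcal G(F^\xi_z)$, $z\in Z$, such that: the agent stops at posterior mean $m$ iff $m>\delta U$; after $z$ he accepts $\langle\hat p,\hat G\rangle\in\mathbb R_+\times\mathcal G(F^\xi_z)$ iff $c_{\hat G}(\delta U)-c_{G^\varnothing_z}(\delta U)\ge\hat p$; for every $z$, $\langle p_z,G_z\rangle$ maximizes $\hat p+\hat G(\delta U)\,\delta V$ over the contracts in $\mathbb R_+\times\mathcal G(F^\xi_z)$ that the agent accepts; and $$U=\mathbb E_\xi[\delta U+c_{G_z}(\delta U)-p_z],\qquad V=\mathbb E_\xi[p_z+G_z(\delta U)\,\delta V],$$ where the two expectations exist. Let $\underline\theta_z=\inf\operatorname{supp}F^\xi_z$, $\bar\theta_z=\sup\operatorname{supp}F^\xi_z$, $Z_A=\{z: r^\xi<\underline\theta_z\}$.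 If $r^\xi\in[\underline\theta_z,\bar\theta_z]$ let $\bar x_z=\sup\{x\in[\underline\theta_z,\bar\theta_z]:\mathbb E_{F^\xi_z}[\theta\mid\theta\le x]\le r^\xi\}$, where the conditional mean at $x=\underline\theta_z$ is read as its limit $\underline\theta_z$. For $k\ge0$ let $Z_B(k)=\{z: r^\xi\in[\underline\theta_z,\bar\theta_z],\ \bar x_z<\bar r-k\}$ and $$\Phi(k)=-\int_{\bar r-k}^{\bar r}(1-F(m))\,dm+\int_{Z_A}\int_{r^\xi}^{\bar r-k}F^\xi_z(m)\,dm\,\xi(dz)+\int_{Z_B(k)}\int_{\bar x_z}^{\bar r-k}\bigl(F^\xi_z(m)-F^\xi_z(\bar x_z)\bigr)\,dm\,\xi(dz).$$ \textbf{Theorem.} For every such public signal $\xi$, a stationary equilibrium exists. The equation $k=\frac{\delta}{1-\delta}\Phi(k)$ has a unique solution $k^*$ in $[0,\infty)$, and $k^*\in[0,\bar r-r^\xi]$. In every stationary equilibrium, $U=u(G^\xi)$ and $V=\bar u-u(G^\xi)-k^*/\delta$. -/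

import Mathlib

open MeasureTheory ProbabilityTheory Set
open scoped NNReal

namespace PersuadedSearch

/-! Distributions on the quality interval `Θ = [a, b]` are represented by Borel measures on `ℝ`
that give mass `0` to the complement of `[a, b]`; their distribution functions are `cdf`. -/

/-- `𝒢(F)`: the mean-preserving contractions of `F`, i.e. the probability distributions `G` on
`[a, b]` with `∫_x^b G(m) dm ≥ ∫_x^b F(m) dm` for all `x ∈ [a, b]`, with equality at `x = a`. -/
def contractions (a b : ℝ) (F : Measure ℝ) : Set (Measure ℝ) :=
  {G | IsProbabilityMeasure G ∧ G (Icc a b)ᶜ = 0 ∧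
    (∀ x ∈ Icc a b, ∫ m in x..b, cdf F m ≤ ∫ m in x..b, cdf G m) ∧
    ∫ m in a..b, cdf G m = ∫ m in a..b, cdf F m}

/-- The incremental-benefit function `c_G(x) = ∫_x^b (1 - G(m)) dm`, for every real `x`
(it is `0` for `x ≥ b`, and the mean of `G` minus `x` for `x ≤ a`). -/
noncomputable def incBenefit (b : ℝ) (G : Measure ℝ) (x : ℝ) : ℝ :=
  ∫ m in x..b, (1 - cdf G m)

/-- The mean of a distribution. -/
noncomputable def mean (G : Measure ℝ) : ℝ := ∫ θ, θ ∂G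

/-- `u` solves the agent's autarky search problem with posterior-mean distribution `G`:
`u = ∫ max {m, δ u} dG(m)`. -/
def SolvesSearch (δ : ℝ) (G : Measure ℝ) (u : ℝ) : Prop :=
  u = ∫ m, max m (δ * u) ∂G

/-- The search problem has exactly one solution. -/
theorem existsUnique_solvesSearch {a b δ : ℝ} (hδ0 : 0 < δ) (hδ1 : δ < 1) (G : Measure ℝ)
    [IsProbabilityMeasure G] (hG : G (Icc a b)ᶜ = 0) : ∃! u, SolvesSearch δ G u := by
  have hint : Integrable (fun m : ℝ => m) G := by
    refine Integrable.of_bound (C := max |a| |b|) measurable_id.aestronglyMeasurable ?_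
    have h : ∀ᵐ m ∂G, m ∈ Icc a b := by
      rw [ae_iff]
      exact hG
    filter_upwards [h] with m hm
    rw [Real.norm_eq_abs]
    exact abs_le_max_abs_abs hm.1 hm.2
  have hmax : ∀ c : ℝ, Integrable (fun m : ℝ => max m c) G := fun c =>
    hint.sup (integrable_const c)
  have hcon : ContractingWith ⟨δ, hδ0.le⟩ (fun u : ℝ => ∫ m, max m (δ * u) ∂G) := by
    refine ⟨by exact_mod_cast hδ1, LipschitzWith.of_dist_le_mul fun u v => ?_⟩
    rw [Real.dist_eq, Real.dist_eq, ← integral_sub (hmax _) (hmax _)]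
    have hb : ∀ᵐ m ∂G, ‖max m (δ * u) - max m (δ * v)‖ ≤ δ * |u - v| := by
      refine Filter.Eventually.of_forall fun m => ?_
      rw [Real.norm_eq_abs]
      refine (abs_max_sub_max_le_max m (δ * u) m (δ * v)).trans ?_
      rw [sub_self, abs_zero, ← mul_sub, abs_mul, abs_of_pos hδ0]
      exact max_le (by positivity) le_rfl
    have h := norm_integral_le_of_norm_le_const hb
    rw [probReal_univ, mul_one] at h
    exact h
  refine ⟨_, (hcon.fixedPoint_isFixedPt).symm, fun v hv => ?_⟩
  exact hcon.fixedPoint_unique (x := v) hv.symm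

/-- `u(G)`: the agent's payoff in the search problem with posterior-mean distribution `G`, the
solution `u` of `u = ∫ max {m, δ u} dG(m)`. -/
noncomputable def searchPayoff (δ : ℝ) (G : Measure ℝ) : ℝ :=
  Classical.epsilon (SolvesSearch δ G)

theorem searchPayoff_spec {a b δ : ℝ} (hδ0 : 0 < δ) (hδ1 : δ < 1) (G : Measure ℝ)
    [IsProbabilityMeasure G] (hG : G (Icc a b)ᶜ = 0) : SolvesSearch δ G (searchPayoff δ G) :=
  Classical.epsilon_spec (existsUnique_solvesSearch hδ0 hδ1 G hG).exists

/-- `r(G) = δ u(G)`: the agent's reservation value. -/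
noncomputable def reservation (δ : ℝ) (G : Measure ℝ) : ℝ := δ * searchPayoff δ G

section PublicSignal

variable {Z : Type*} [MeasurableSpace Z]

/-- `β z` is (a version of) the posterior belief about the quality, given prior `F` and
realization `z` of the signal structure `ξ`: drawing `θ ∼ F` and then `z ∼ ξ(θ)` gives the same
joint law as drawing `z` from its marginal law and then `θ ∼ β z`. -/
def IsBayesPosterior (F : Measure ℝ) (ξ : Kernel ℝ Z) (β : Kernel Z ℝ) : Prop :=
  (F ⊗ₘ ξ).map Prod.swap = (F.bind ξ) ⊗ₘ β

/-- The law of the posterior mean, `G^ξ`, when `z` has law `ν` and posterior belief `β z`. -/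
noncomputable def posteriorMeanLaw (ν : Measure Z) (β : Kernel Z ℝ) : Measure ℝ :=
  ν.map fun z => mean (β z)

/-- The uninformative second signal `G^∅_z`: unit mass at the mean of the interim belief `B`. -/
noncomputable def uninformative (B : Measure ℝ) : Measure ℝ := Measure.dirac (mean B)

/-- With interim belief `B` and continuation value `U`, the agent accepts the contract
`⟨p, G⟩` iff `c_G(δ U) - c_{G^∅}(δ U) ≥ p`. -/
def Accepts (b δ U : ℝ) (B : Measure ℝ) (p : ℝ) (G : Measure ℝ) : Prop :=
  p ≤ incBenefit b G (δ * U) - incBenefit b (uninformative B) (δ * U)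

/-- The principal's profit from an accepted contract `⟨p, G⟩`. The agent stops iff the posterior
mean `m` satisfies `m > δ U`, so he continues with probability `G(δ U)`. -/
noncomputable def profit (δ U V p : ℝ) (G : Measure ℝ) : ℝ := p + cdf G (δ * U) * (δ * V)

/-- The agent's payoff from accepting the contract `⟨p, G⟩`, given that he stops iff
`m > δ U`. -/
noncomputable def agentPayoff (b δ U p : ℝ) (G : Measure ℝ) : ℝ :=
  δ * U + incBenefit b G (δ * U) - p

/-- Stationary equilibrium with a public signal: `ν` is the law of the public realization `z`,
`β z` the interim belief, `(U, V)` the continuation values of the agent and the principal, and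
`⟨p z, G z⟩` the contract proposed after `z`. -/
structure IsStationaryEquilibrium (a b δ : ℝ) (ν : Measure Z) (β : Kernel Z ℝ)
    (U V : ℝ) (p : Z → ℝ) (G : Z → Measure ℝ) : Prop where
  price_nonneg : ∀ z, 0 ≤ p z
  feasible : ∀ z, G z ∈ contractions a b (β z)
  accepted : ∀ z, Accepts b δ U (β z) (p z) (G z)
  optimal : ∀ z, ∀ q : ℝ, 0 ≤ q → ∀ H ∈ contractions a b (β z), Accepts b δ U (β z) q H →
    profit δ U V q H ≤ profit δ U V (p z) (G z)
  integrable_agent : Integrable (fun z => agentPayoff b δ U (p z) (G z)) ν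
  agent_value : U = ∫ z, agentPayoff b δ U (p z) (G z) ∂ν
  integrable_principal : Integrable (fun z => profit δ U V (p z) (G z)) ν
  principal_value : V = ∫ z, profit δ U V (p z) (G z) ∂ν

/-- The lower end of the support of a belief. -/
noncomputable def suppInf (B : Measure ℝ) : ℝ := sInf B.support

/-- The upper end of the support of a belief. -/
noncomputable def suppSup (B : Measure ℝ) : ℝ := sSup B.support

open Classical in
/-- `E_B[θ | θ ≤ x]`. If `θ ≤ x` has probability `0`, the value is `x`; for the atomless beliefs
considered here and `x` in the hull of the support this only concerns the lower end of the
support, where `x` is the limit of the conditional means from the right. -/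
noncomputable def condMeanBelow (B : Measure ℝ) (x : ℝ) : ℝ :=
  if B (Iic x) = 0 then x else (∫ θ in Iic x, θ ∂B) / B.real (Iic x)

/-- `x̄ = sup {x ∈ [inf supp B, sup supp B] : E_B[θ | θ ≤ x] ≤ r}`. -/
noncomputable def maxCutoff (r : ℝ) (B : Measure ℝ) : ℝ :=
  sSup {x | x ∈ Icc (suppInf B) (suppSup B) ∧ condMeanBelow B x ≤ r}

/-- `Z_A`, with `r = r^ξ`. -/
def setA (r : ℝ) (β : Kernel Z ℝ) : Set Z := {z | r < suppInf (β z)}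

/-- `Z_B(k)`, with `r = r^ξ` and `rbar` the efficient reservation value. -/
def setB (r rbar : ℝ) (β : Kernel Z ℝ) (k : ℝ) : Set Z :=
  {z | r ∈ Icc (suppInf (β z)) (suppSup (β z)) ∧ maxCutoff r (β z) < rbar - k}

/-- The function `Φ`, with `r = r^ξ` and `rbar` the efficient reservation value. -/
noncomputable def Phi (F : Measure ℝ) (ν : Measure Z) (β : Kernel Z ℝ) (r rbar k : ℝ) : ℝ :=
  -(∫ m in (rbar - k)..rbar, (1 - cdf F m))
    + (∫ z in setA r β, (∫ m in r..(rbar - k), cdf (β z) m) ∂ν)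
    + ∫ z in setB r rbar β k,
        (∫ m in (maxCutoff r (β z))..(rbar - k), (cdf (β z) m - cdf (β z) (maxCutoff r (β z)))) ∂ν

end PublicSignal

end PersuadedSearch

/-!
The proof reduces equilibrium to a one-dimensional fixed point problem for the principal's
discounted continuation value `w = δ V`.

The principal prices every signal so that acceptance binds (`IsStationaryEquilibrium.price_eq`).
The agent is therefore left with his value of searching with the public signal alone, which is
characterized by `U = ∫ max {m, δ U} dG^ξ(m)`; hence `U = u(G^ξ)` and he stops above `r = r^ξ`.
Selling no information for free shows `V ≥ 0`.

After a realization with interim belief `B`, the principal then maximizes `c_G(r) + w G(r)` over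
the contractions `G` of `B`. The efficient rule stops above `y = r + w`. Let `X` be the largest
threshold such that types below `X` have conditional mean at most `r` (`cutoff`). Pooling the types
below `min X y` and revealing the others is optimal: it yields the efficient surplus less
`loss = ∫_r^y (B(m) - B(X))⁺ dm` (`surplus_poolBelow`). No contraction does better (`surplus_le`),
because `c_G` is convex with slope `G - 1` and `c_G ≤ c_B`: comparing the tangent of `c_G` at `r`
with `c_B` at `y` gives the efficient bound, and comparing it with `c_B` at `X`, where the
constraint on the pooled mean binds, gives the other one (`surplus_le_of_binding`).

Averaging over the public signal, `V` is the principal's equilibrium value if and only if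
`k = rbar - r - w` solves `k = δ / (1 - δ) * Φ(k)` (`integral_maxProfit_eq_iff`), because `Φ` is the
expected loss minus `∫_y^rbar (1 - F)` (`Phi_eq`). On `(-∞, rbar - r]` the function `Φ` is
continuous and nonincreasing, `Φ(0) ≥ 0`, and `Φ ≤ 0` from `rbar - r` on. So there is exactly one
solution, it lies in `[0, rbar - r]`, and the pooling contracts turn it into an equilibrium.
-/

namespace PersuadedSearch

/-! ### Distributions on an interval and their incremental benefits -/

theorem ae_mem_Icc {a b : ℝ} {G : Measure ℝ} (hG : G (Icc a b)ᶜ = 0) :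
    ∀ᵐ m ∂G, m ∈ Icc a b := by
  rw [ae_iff]
  exact hG

theorem integrable_id_of_Icc {a b : ℝ} {G : Measure ℝ} [IsFiniteMeasure G]
    (hG : G (Icc a b)ᶜ = 0) : Integrable (fun m : ℝ => m) G := by
  refine Integrable.of_bound (C := max |a| |b|) measurable_id.aestronglyMeasurable ?_
  filter_upwards [ae_mem_Icc hG] with m hm
  rw [Real.norm_eq_abs]
  exact abs_le_max_abs_abs hm.1 hm.2

theorem integrable_posPart_of_Icc {a b : ℝ} {G : Measure ℝ} [IsFiniteMeasure G]
    (hG : G (Icc a b)ᶜ = 0) (x : ℝ) : Integrable (fun m : ℝ => max (m - x) 0) G :=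
  ((integrable_id_of_Icc hG).sub (integrable_const x)).sup (integrable_const 0)

theorem mean_mem_Icc {a b : ℝ} {G : Measure ℝ} [IsProbabilityMeasure G]
    (hG : G (Icc a b)ᶜ = 0) : mean G ∈ Icc a b := by
  have h1 : ∫ _, a ∂G ≤ ∫ m, m ∂G :=
    integral_mono_ae (integrable_const a) (integrable_id_of_Icc hG)
      ((ae_mem_Icc hG).mono fun m hm => hm.1)
  have h2 : ∫ m, m ∂G ≤ ∫ _, b ∂G :=
    integral_mono_ae (integrable_id_of_Icc hG) (integrable_const b)
      ((ae_mem_Icc hG).mono fun m hm => hm.2)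
  simp only [integral_const, probReal_univ, one_smul] at h1 h2
  exact ⟨h1, h2⟩

theorem one_sub_cdf (G : Measure ℝ) [IsProbabilityMeasure G] (x : ℝ) :
    1 - cdf G x = G.real (Ioi x) := by
  rw [cdf_eq_real, ← compl_Iic, probReal_compl_eq_one_sub measurableSet_Iic]

theorem cdf_eq_one_of_le {a b x : ℝ} {G : Measure ℝ} [IsProbabilityMeasure G]
    (hG : G (Icc a b)ᶜ = 0) (hx : b ≤ x) : cdf G x = 1 := by
  have h : G.real (Ioi x) = 0 := by
    rw [measureReal_def, measure_mono_null _ hG, ENNReal.toReal_zero]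
    exact fun m hm hm' => absurd (hm'.2.trans hx) (not_le.2 hm)
  linarith [one_sub_cdf G x]

theorem intervalIntegrable_cdf (G : Measure ℝ) (x y : ℝ) :
    IntervalIntegrable (fun m => cdf G m) volume x y :=
  (monotone_cdf G).intervalIntegrable

theorem intervalIntegrable_one_sub_cdf (G : Measure ℝ) (x y : ℝ) :
    IntervalIntegrable (fun m => 1 - cdf G m) volume x y :=
  intervalIntegrable_const.sub (intervalIntegrable_cdf G x y)

theorem incBenefit_sub_incBenefit (b : ℝ) (G : Measure ℝ) (x y : ℝ) :
    incBenefit b G x - incBenefit b G y = ∫ m in x..y, (1 - cdf G m) := by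
  rw [incBenefit, incBenefit, sub_eq_iff_eq_add]
  exact (intervalIntegral.integral_add_adjacent_intervals
    (intervalIntegrable_one_sub_cdf G x y) (intervalIntegrable_one_sub_cdf G y b)).symm

theorem incBenefit_eq_zero {a b x : ℝ} {G : Measure ℝ} [IsProbabilityMeasure G]
    (hG : G (Icc a b)ᶜ = 0) (hx : b ≤ x) : incBenefit b G x = 0 := by
  rw [incBenefit, intervalIntegral.integral_symm, neg_eq_zero]
  refine (intervalIntegral.integral_congr (g := fun _ => 0) fun m hm => ?_).trans
    intervalIntegral.integral_zero
  rw [uIcc_of_le hx] at hm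
  simp [cdf_eq_one_of_le hG hm.1]

/-- The incremental benefit is the price of a call option on the posterior mean; this is Fubini's
theorem. -/
theorem incBenefit_eq_integral {a b : ℝ} {G : Measure ℝ} [IsProbabilityMeasure G]
    (hG : G (Icc a b)ᶜ = 0) (x : ℝ) : incBenefit b G x = ∫ m, max (m - x) 0 ∂G := by
  rcases le_total b x with hx | hx
  · rw [incBenefit_eq_zero hG hx]
    refine (integral_eq_zero_of_ae ?_).symm
    filter_upwards [ae_mem_Icc hG] with m hm
    simp only [Pi.zero_apply, max_eq_right_iff]
    linarith [hm.2]
  · have h1 : ∀ s, 1 - cdf G s = ∫ m, (if s < m then (1 : ℝ) else 0) ∂G := fun s => by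
      rw [one_sub_cdf, ← integral_indicator_one measurableSet_Ioi]
      rfl
    have hmeas : Measurable (Function.uncurry fun (s m : ℝ) => if s < m then (1 : ℝ) else 0) :=
      Measurable.ite (measurableSet_lt measurable_fst measurable_snd) measurable_const
        measurable_const
    simp only [incBenefit, h1, intervalIntegral.integral_of_le hx]
    rw [integral_integral_swap]
    · refine integral_congr_ae ?_
      filter_upwards [ae_mem_Icc hG] with m hm
      have h2 : (fun s => if s < m then (1 : ℝ) else 0) = (Iio m).indicator 1 := by
        ext s
        simp [indicator]
      rw [h2, integral_indicator_one measurableSet_Iio, measureReal_restrict_apply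
        measurableSet_Iio]
      have h3 : Iio m ∩ Ioc x b = Ioo x m := by
        ext s
        simp only [mem_inter_iff, mem_Iio, mem_Ioc, mem_Ioo]
        exact ⟨fun h => ⟨h.2.1, h.1⟩, fun h => ⟨h.2, h.1, h.2.le.trans hm.2⟩⟩
      rw [h3, Real.volume_real_Ioo]
    · refine Integrable.of_bound (C := 1) hmeas.aestronglyMeasurable
        (Filter.Eventually.of_forall fun p => ?_)
      simp only [Function.uncurry]
      split_ifs <;> simp

theorem incBenefit_nonneg {a b : ℝ} {G : Measure ℝ} [IsProbabilityMeasure G]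
    (hG : G (Icc a b)ᶜ = 0) (x : ℝ) : 0 ≤ incBenefit b G x := by
  rw [incBenefit_eq_integral hG]
  exact integral_nonneg fun m => le_max_right _ _

theorem mean_sub_le_incBenefit {a b : ℝ} {G : Measure ℝ} [IsProbabilityMeasure G]
    (hG : G (Icc a b)ᶜ = 0) (x : ℝ) : mean G - x ≤ incBenefit b G x := by
  rw [incBenefit_eq_integral hG]
  have h : ∫ m, (m - x) ∂G ≤ ∫ m, max (m - x) 0 ∂G :=
    integral_mono ((integrable_id_of_Icc hG).sub (integrable_const x))
      (integrable_posPart_of_Icc hG x) fun m => le_max_left _ _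
  rw [integral_sub (integrable_id_of_Icc hG) (integrable_const x)] at h
  simpa [mean] using h

theorem incBenefit_left {a b : ℝ} {G : Measure ℝ} [IsProbabilityMeasure G]
    (hG : G (Icc a b)ᶜ = 0) : incBenefit b G a = mean G - a := by
  rw [incBenefit_eq_integral hG]
  have h : ∫ m, max (m - a) 0 ∂G = ∫ m, (m - a) ∂G := by
    refine integral_congr_ae ?_
    filter_upwards [ae_mem_Icc hG] with m hm
    exact max_eq_left (by linarith [hm.1])
  rw [h, integral_sub (integrable_id_of_Icc hG) (integrable_const a)]
  simp [mean]

theorem integral_max_eq {a b : ℝ} {G : Measure ℝ} [IsProbabilityMeasure G]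
    (hG : G (Icc a b)ᶜ = 0) (x : ℝ) : ∫ m, max m x ∂G = x + incBenefit b G x := by
  rw [incBenefit_eq_integral hG]
  have h : ∀ m : ℝ, max m x = x + max (m - x) 0 := fun m => by
    rw [← max_add_add_left]
    simp
  simp only [h]
  rw [integral_add (integrable_const x) (integrable_posPart_of_Icc hG x)]
  simp

theorem incBenefit_dirac {a b m : ℝ} (hm : m ∈ Icc a b) (x : ℝ) :
    incBenefit b (Measure.dirac m) x = max (m - x) 0 := by
  have h : (Measure.dirac m) (Icc a b)ᶜ = 0 := by
    simp [hm.1, hm.2]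
  rw [incBenefit_eq_integral h, integral_dirac]

theorem incBenefit_uninformative {a b : ℝ} {B : Measure ℝ} [IsProbabilityMeasure B]
    (hB : B (Icc a b)ᶜ = 0) (x : ℝ) :
    incBenefit b (uninformative B) x = max (mean B - x) 0 :=
  incBenefit_dirac (mean_mem_Icc hB) x

/-- `c_G` is convex with slope `G - 1`: the tangent at `y` lies below. -/
theorem incBenefit_add_le (b : ℝ) (G : Measure ℝ) {x y : ℝ} (hxy : x ≤ y) :
    incBenefit b G y + (y - x) * (1 - cdf G y) ≤ incBenefit b G x := by
  have h : ∫ _ in x..y, (1 - cdf G y) ≤ ∫ m in x..y, (1 - cdf G m) :=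
    intervalIntegral.integral_mono_on hxy intervalIntegrable_const
      (intervalIntegrable_one_sub_cdf G x y) fun m hm =>
        sub_le_sub_left (monotone_cdf G hm.2) 1
  rw [intervalIntegral.integral_const, smul_eq_mul, ← incBenefit_sub_incBenefit b] at h
  linarith

/-- `c_G` is convex with slope `G - 1`: the tangent at `x` lies below. -/
theorem incBenefit_le_add (b : ℝ) (G : Measure ℝ) {x y : ℝ} (hxy : x ≤ y) :
    incBenefit b G x ≤ incBenefit b G y + (y - x) * (1 - cdf G x) := by
  have h : ∫ m in x..y, (1 - cdf G m) ≤ ∫ _ in x..y, (1 - cdf G x) :=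
    intervalIntegral.integral_mono_on hxy (intervalIntegrable_one_sub_cdf G x y)
      intervalIntegrable_const fun m hm => sub_le_sub_left (monotone_cdf G hm.1) 1
  rw [intervalIntegral.integral_const, smul_eq_mul, ← incBenefit_sub_incBenefit b] at h
  linarith

theorem setIntegral_Ioi_sub {a b : ℝ} {G : Measure ℝ} [IsProbabilityMeasure G]
    (hG : G (Icc a b)ᶜ = 0) (r t : ℝ) :
    ∫ m in Ioi t, (m - r) ∂G = incBenefit b G t + (t - r) * (1 - cdf G t) := by
  rw [incBenefit_eq_integral hG, one_sub_cdf, ← integral_indicator measurableSet_Ioi,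
    ← integral_indicator_one measurableSet_Ioi, ← integral_const_mul,
    ← integral_add (integrable_posPart_of_Icc hG t)]
  · refine integral_congr_ae (Filter.Eventually.of_forall fun m => ?_)
    by_cases hm : t < m
    · simp [hm, max_eq_left (sub_nonneg.2 hm.le)]
    · simp [hm, not_lt.1 hm]
  · exact ((integrable_const (1 : ℝ)).indicator measurableSet_Ioi).const_mul _

theorem setIntegral_Iic_sub {a b : ℝ} {G : Measure ℝ} [IsProbabilityMeasure G]
    (hG : G (Icc a b)ᶜ = 0) (r t : ℝ) :
    ∫ m in Iic t, (m - r) ∂G =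
      mean G - r - (incBenefit b G t + (t - r) * (1 - cdf G t)) := by
  have hint : Integrable (fun m => m - r) G :=
    (integrable_id_of_Icc hG).sub (integrable_const r)
  have h := integral_add_compl (measurableSet_Iic (a := t)) hint
  rw [compl_Iic, setIntegral_Ioi_sub hG, integral_sub (integrable_id_of_Icc hG)
    (integrable_const r)] at h
  simp only [integral_const, probReal_univ, one_smul] at h
  rw [mean]
  linarith

theorem continuous_cdf {B : Measure ℝ} [IsProbabilityMeasure B] (hB : ∀ x, B {x} = 0) :
    Continuous (cdf B) := by
  rw [continuous_iff_continuousAt]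
  intro x
  rw [continuousAt_iff_continuous_left'_right']
  have hr := ((cdf B).right_continuous x).mono Ioi_subset_Ici_self
  refine ⟨?_, hr⟩
  have h1 := (cdf B).measure_singleton x
  rw [measure_cdf, hB, eq_comm, ENNReal.ofReal_eq_zero] at h1
  have h2 := (cdf B).mono.leftLim_le (le_refl x)
  have h3 : Function.leftLim (cdf B) x = cdf B x := by linarith
  exact (cdf B).mono.continuousWithinAt_Iio_iff_leftLim_eq.2 h3

theorem continuous_incBenefit (b : ℝ) (G : Measure ℝ) : Continuous (incBenefit b G) := by
  have h := (intervalIntegral.continuous_primitive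
    (fun x y => intervalIntegrable_one_sub_cdf G x y) b).neg
  refine h.congr fun x => ?_
  rw [incBenefit, intervalIntegral.integral_symm, Pi.neg_apply]

/-! ### Mean-preserving contractions -/

theorem incBenefit_eq_sub (b : ℝ) (G : Measure ℝ) (x : ℝ) :
    incBenefit b G x = (b - x) - ∫ m in x..b, cdf G m := by
  rw [incBenefit, intervalIntegral.integral_sub intervalIntegrable_const
    (intervalIntegrable_cdf G x b)]
  simp

theorem mean_eq_of_mem_contractions {a b : ℝ} {B G : Measure ℝ} [IsProbabilityMeasure B]
    (hB : B (Icc a b)ᶜ = 0) (hG : G ∈ contractions a b B) : mean G = mean B := by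
  obtain ⟨h1, h2, -, h4⟩ := hG
  have := incBenefit_left h2
  have := incBenefit_left hB
  have := incBenefit_eq_sub b G a
  have := incBenefit_eq_sub b B a
  linarith

theorem incBenefit_le_of_mem_contractions {a b : ℝ} {B G : Measure ℝ} [IsProbabilityMeasure B]
    (hB : B (Icc a b)ᶜ = 0) (hG : G ∈ contractions a b B) {x : ℝ} (hx : a ≤ x) :
    incBenefit b G x ≤ incBenefit b B x := by
  obtain ⟨h1, h2, h3, -⟩ := hG
  rcases le_total x b with hxb | hxb
  · rw [incBenefit_eq_sub, incBenefit_eq_sub]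
    linarith [h3 x ⟨hx, hxb⟩]
  · rw [incBenefit_eq_zero h2 hxb, incBenefit_eq_zero hB hxb]

theorem mem_contractions {a b : ℝ} {B G : Measure ℝ} [IsProbabilityMeasure B]
    (hB : B (Icc a b)ᶜ = 0) [IsProbabilityMeasure G] (hG : G (Icc a b)ᶜ = 0)
    (hmean : mean G = mean B)
    (hle : ∀ x, incBenefit b G x ≤ incBenefit b B x) : G ∈ contractions a b B := by
  refine ⟨inferInstance, hG, fun x _ => ?_, ?_⟩
  · have := hle x
    rw [incBenefit_eq_sub, incBenefit_eq_sub] at this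
    linarith
  · have := incBenefit_left hG
    have := incBenefit_left hB
    have := incBenefit_eq_sub b G a
    have := incBenefit_eq_sub b B a
    linarith

/-- Any contraction is worth at least as much to the agent as no information (Jensen). -/
theorem incBenefit_uninformative_le {a b : ℝ} {B G : Measure ℝ} [IsProbabilityMeasure B]
    (hB : B (Icc a b)ᶜ = 0) (hG : G ∈ contractions a b B) (x : ℝ) :
    incBenefit b (uninformative B) x ≤ incBenefit b G x := by
  have := hG.1
  rw [incBenefit_uninformative hB, ← mean_eq_of_mem_contractions hB hG]
  exact max_le (mean_sub_le_incBenefit hG.2.1 x) (incBenefit_nonneg hG.2.1 x)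

theorem uninformative_mem_contractions {a b : ℝ} {B : Measure ℝ} [IsProbabilityMeasure B]
    (hB : B (Icc a b)ᶜ = 0) : uninformative B ∈ contractions a b B := by
  have hm := mean_mem_Icc hB
  have : IsProbabilityMeasure (uninformative B) := by
    unfold uninformative; infer_instance
  refine mem_contractions hB ?_ ?_ fun x => ?_
  · simp [uninformative, hm.1, hm.2]
  · simp [uninformative, mean]
  · rw [incBenefit_uninformative hB]
    exact max_le (mean_sub_le_incBenefit hB x) (incBenefit_nonneg hB x)

/-! ### Pooling the low types -/

/-- The distribution of posterior means when all types `θ ≤ t` are pooled and all types `θ > t`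
are revealed. If `θ ≤ t` has probability `0`, the position of the pooled atom is irrelevant since
its weight is `0`. -/
noncomputable def poolBelow (t : ℝ) (B : Measure ℝ) : Measure ℝ :=
  B.restrict (Ioi t) +
    B (Iic t) • Measure.dirac ((∫ θ in Iic t, θ ∂B) / B.real (Iic t))

instance (t : ℝ) (B : Measure ℝ) [IsProbabilityMeasure B] :
    IsProbabilityMeasure (poolBelow t B) := by
  constructor
  simp only [poolBelow, Measure.add_apply, Measure.restrict_apply_univ, Measure.smul_apply,
    measure_univ, smul_eq_mul, mul_one]
  rw [← compl_Iic, add_comm, prob_add_prob_compl measurableSet_Iic]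

theorem integral_poolBelow {t : ℝ} {B : Measure ℝ} [IsProbabilityMeasure B] {f : ℝ → ℝ}
    (hf : Integrable f B) : ∫ m, f m ∂(poolBelow t B) =
      ∫ m in Ioi t, f m ∂B + B.real (Iic t) * f ((∫ θ in Iic t, θ ∂B) / B.real (Iic t)) := by
  rw [poolBelow, integral_add_measure hf.restrict, integral_smul_measure, integral_dirac]
  · rfl
  · exact (integrable_dirac (by simp)).smul_measure (measure_ne_top _ _)

theorem mul_poolMean {t : ℝ} {B : Measure ℝ} [IsProbabilityMeasure B] :
    B.real (Iic t) * ((∫ θ in Iic t, θ ∂B) / B.real (Iic t)) = ∫ θ in Iic t, θ ∂B := by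
  by_cases h : B.real (Iic t) = 0
  · have h' : B (Iic t) = 0 := (measureReal_eq_zero_iff).1 h
    rw [h, zero_mul, Measure.restrict_eq_zero.2 h', integral_zero_measure]
  · field_simp

theorem mean_poolBelow {a b t : ℝ} {B : Measure ℝ} [IsProbabilityMeasure B]
    (hB : B (Icc a b)ᶜ = 0) : mean (poolBelow t B) = mean B := by
  rw [mean, integral_poolBelow (integrable_id_of_Icc hB), mul_poolMean, add_comm, mean,
    ← integral_add_compl (measurableSet_Iic (a := t)) (integrable_id_of_Icc hB), compl_Iic]

/-- The pooled types satisfy a weighted form of Jensen's inequality for option payoffs. -/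
theorem mul_posPart_poolMean_le {a b : ℝ} {B : Measure ℝ} [IsProbabilityMeasure B]
    (hB : B (Icc a b)ᶜ = 0) (t x : ℝ) :
    B.real (Iic t) * max ((∫ θ in Iic t, θ ∂B) / B.real (Iic t) - x) 0 ≤
      ∫ m in Iic t, max (m - x) 0 ∂B := by
  rw [mul_max_of_nonneg _ _ measureReal_nonneg, mul_sub, mul_poolMean, mul_zero]
  refine max_le ?_ (integral_nonneg fun m => le_max_right _ _)
  have h : ∫ m in Iic t, (m - x) ∂B ≤ ∫ m in Iic t, max (m - x) 0 ∂B :=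
    integral_mono ((integrable_id_of_Icc hB).sub (integrable_const x)).restrict
      (integrable_posPart_of_Icc hB x).restrict fun m => le_max_left _ _
  rw [integral_sub (integrable_id_of_Icc hB).restrict (integrable_const x)] at h
  simpa using h

theorem poolBelow_compl_Icc {a b : ℝ} {B : Measure ℝ} [IsProbabilityMeasure B]
    (hB : B (Icc a b)ᶜ = 0) (t : ℝ) : poolBelow t B (Icc a b)ᶜ = 0 := by
  rw [poolBelow, Measure.add_apply, Measure.smul_apply, add_eq_zero]
  refine ⟨le_antisymm ((Measure.restrict_le_self _).trans hB.le) zero_le, ?_⟩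
  by_cases h : B (Iic t) = 0
  · simp [h]
  · have hpos : 0 < B.real (Iic t) := measureReal_nonneg.lt_of_ne' fun h' => h ((measureReal_eq_zero_iff).1 h')
    have hint := (integrable_id_of_Icc hB).restrict (s := Iic t)
    have h1 : ∫ _ in Iic t, a ∂B ≤ ∫ m in Iic t, m ∂B :=
      integral_mono_ae (integrable_const a) hint
        (ae_restrict_of_ae ((ae_mem_Icc hB).mono fun m hm => hm.1))
    have h2 : ∫ m in Iic t, m ∂B ≤ ∫ _ in Iic t, b ∂B :=
      integral_mono_ae hint (integrable_const b)
        (ae_restrict_of_ae ((ae_mem_Icc hB).mono fun m hm => hm.2))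
    simp only [integral_const, measureReal_restrict_apply_univ, smul_eq_mul] at h1 h2
    have : (∫ θ in Iic t, θ ∂B) / B.real (Iic t) ∈ Icc a b :=
      ⟨by rw [le_div_iff₀ hpos]; linarith, by rw [div_le_iff₀ hpos]; linarith⟩
    rw [Measure.dirac_apply' _ measurableSet_Icc.compl]
    simp [this.1, this.2]

theorem poolBelow_mem_contractions {a b : ℝ} {B : Measure ℝ} [IsProbabilityMeasure B]
    (hB : B (Icc a b)ᶜ = 0) (t : ℝ) : poolBelow t B ∈ contractions a b B := by
  refine mem_contractions hB (poolBelow_compl_Icc hB t) (mean_poolBelow hB) fun x => ?_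
  rw [incBenefit_eq_integral (poolBelow_compl_Icc hB t), incBenefit_eq_integral hB,
    integral_poolBelow (integrable_posPart_of_Icc hB x),
    ← integral_add_compl (measurableSet_Iic (a := t)) (integrable_posPart_of_Icc hB x), compl_Iic]
  linarith [mul_posPart_poolMean_le hB t x]

/-- If the pooled types are on average not better than `r ≤ t`, exactly the pooled types
continue to search at the reservation value `r`. -/
theorem cdf_poolBelow {B : Measure ℝ} [IsProbabilityMeasure B] {r t : ℝ} (hrt : r ≤ t)
    (h : B (Iic t) ≠ 0 → (∫ θ in Iic t, θ ∂B) / B.real (Iic t) ≤ r) :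
    cdf (poolBelow t B) r = cdf B t := by
  have h0 : Iic r ∩ Ioi t = ∅ := by
    ext s
    simp only [mem_inter_iff, mem_Iic, mem_Ioi, mem_empty_iff_false, iff_false, not_and, not_lt]
    exact fun hs => hs.trans hrt
  rw [cdf_eq_real, cdf_eq_real, measureReal_def, measureReal_def, poolBelow, Measure.add_apply,
    Measure.restrict_apply measurableSet_Iic, h0, measure_empty, zero_add, Measure.smul_apply,
    Measure.dirac_apply' _ measurableSet_Iic, smul_eq_mul]
  by_cases hz : B (Iic t) = 0
  · simp [hz]
  · rw [indicator_of_mem (by exact h hz)]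
    simp

theorem incBenefit_poolBelow {a b : ℝ} {B : Measure ℝ} [IsProbabilityMeasure B]
    (hB : B (Icc a b)ᶜ = 0) {r t : ℝ} (hrt : r ≤ t)
    (h : B (Iic t) ≠ 0 → (∫ θ in Iic t, θ ∂B) / B.real (Iic t) ≤ r) :
    incBenefit b (poolBelow t B) r = incBenefit b B t + (t - r) * (1 - cdf B t) := by
  rw [incBenefit_eq_integral (poolBelow_compl_Icc hB t),
    integral_poolBelow (integrable_posPart_of_Icc hB r), ← setIntegral_Ioi_sub hB]
  have h1 : ∫ m in Ioi t, max (m - r) 0 ∂B = ∫ m in Ioi t, (m - r) ∂B :=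
    setIntegral_congr_fun measurableSet_Ioi fun m hm =>
      max_eq_left (by linarith [mem_Ioi.1 hm])
  rw [h1]
  by_cases hz : B (Iic t) = 0
  · simp [measureReal_def, hz]
  · rw [max_eq_right (by linarith [h hz]), mul_zero, add_zero]

/-! ### The principal's cutoff -/

theorem le_suppInf_iff {a b : ℝ} {B : Measure ℝ} [IsProbabilityMeasure B]
    (hB : B (Icc a b)ᶜ = 0) {t : ℝ} : t ≤ suppInf B ↔ B (Iio t) = 0 := by
  have hsub : B.support ⊆ Icc a b := Measure.support_subset_of_isClosed isClosed_Icc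
    (ae_mem_Icc hB)
  refine ⟨fun h => measure_mono_null (t := B.supportᶜ) (fun s hs hs' => ?_) Measure.measure_compl_support,
    fun h => le_csInf (Measure.nonempty_support (IsProbabilityMeasure.ne_zero B)) fun s hs => ?_⟩
  · exact absurd (csInf_le (bddBelow_Icc.mono hsub) hs') (not_le.2 (lt_of_lt_of_le hs h))
  · by_contra hst
    exact Measure.subset_compl_support_of_isOpen isOpen_Iio h (not_le.1 hst) hs

theorem suppSup_le_iff {a b : ℝ} {B : Measure ℝ} [IsProbabilityMeasure B]
    (hB : B (Icc a b)ᶜ = 0) {t : ℝ} : suppSup B ≤ t ↔ B (Ioi t) = 0 := by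
  have hsub : B.support ⊆ Icc a b := Measure.support_subset_of_isClosed isClosed_Icc
    (ae_mem_Icc hB)
  refine ⟨fun h => measure_mono_null (t := B.supportᶜ) (fun s hs hs' => ?_) Measure.measure_compl_support,
    fun h => csSup_le (Measure.nonempty_support (IsProbabilityMeasure.ne_zero B)) fun s hs => ?_⟩
  · exact absurd (le_csSup (bddAbove_Icc.mono hsub) hs') (not_le.2 (lt_of_le_of_lt h hs))
  · by_contra hst
    exact Measure.subset_compl_support_of_isOpen isOpen_Ioi h (not_le.1 hst) hs

theorem cdf_eq_one_of_suppSup_le {a b : ℝ} {B : Measure ℝ} [IsProbabilityMeasure B]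
    (hB : B (Icc a b)ᶜ = 0) {t : ℝ} (h : suppSup B ≤ t) : cdf B t = 1 := by
  have h1 := one_sub_cdf B t
  rw [measureReal_def, (suppSup_le_iff hB).1 h, ENNReal.toReal_zero] at h1
  linarith

theorem measure_Iic_eq_zero_iff {a b : ℝ} {B : Measure ℝ} [IsProbabilityMeasure B]
    (hB : B (Icc a b)ᶜ = 0) (hat : ∀ x, B {x} = 0) {t : ℝ} :
    B (Iic t) = 0 ↔ t ≤ suppInf B := by
  rw [le_suppInf_iff hB, ← Iio_union_right]
  refine ⟨fun h => measure_mono_null subset_union_left h, fun h => ?_⟩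
  exact measure_union_null h (hat t)

theorem setIntegral_Iic_sub_mono {a b : ℝ} {B : Measure ℝ} [IsProbabilityMeasure B]
    (hB : B (Icc a b)ᶜ = 0) {r s t : ℝ} (hrs : r ≤ s) (hst : s ≤ t) :
    ∫ m in Iic s, (m - r) ∂B ≤ ∫ m in Iic t, (m - r) ∂B := by
  rw [setIntegral_Iic_sub hB, setIntegral_Iic_sub hB]
  have h1 := incBenefit_add_le b B hst
  have h2 := mul_le_mul_of_nonneg_left (monotone_cdf B hst) (sub_nonneg.2 hrs)
  linarith

theorem continuous_setIntegral_Iic_sub {a b : ℝ} {B : Measure ℝ} [IsProbabilityMeasure B]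
    (hB : B (Icc a b)ᶜ = 0) (hat : ∀ x, B {x} = 0) (r : ℝ) :
    Continuous fun t => ∫ m in Iic t, (m - r) ∂B := by
  simp only [setIntegral_Iic_sub hB]
  have h1 := continuous_incBenefit b B
  have h2 := continuous_cdf hat
  fun_prop

theorem setIntegral_Iic_self_nonpos (B : Measure ℝ) (r : ℝ) :
    ∫ m in Iic r, (m - r) ∂B ≤ 0 :=
  setIntegral_nonpos measurableSet_Iic fun _ hm => sub_nonpos.2 hm

theorem setIntegral_Iic_sub_eq {a b : ℝ} {B : Measure ℝ} [IsProbabilityMeasure B]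
    (hB : B (Icc a b)ᶜ = 0) (r t : ℝ) :
    ∫ m in Iic t, (m - r) ∂B = (∫ m in Iic t, m ∂B) - r * B.real (Iic t) := by
  rw [integral_sub (integrable_id_of_Icc hB).restrict (integrable_const r)]
  simp [mul_comm]

theorem poolMean_le_iff {a b : ℝ} {B : Measure ℝ} [IsProbabilityMeasure B]
    (hB : B (Icc a b)ᶜ = 0) {r t : ℝ} (h : B (Iic t) ≠ 0) :
    (∫ θ in Iic t, θ ∂B) / B.real (Iic t) ≤ r ↔ ∫ m in Iic t, (m - r) ∂B ≤ 0 := by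
  have hpos : 0 < B.real (Iic t) :=
    measureReal_nonneg.lt_of_ne' fun h' => h ((measureReal_eq_zero_iff).1 h')
  rw [div_le_iff₀ hpos, setIntegral_Iic_sub_eq hB, sub_nonpos]

theorem condMeanBelow_le_iff {a b : ℝ} {B : Measure ℝ} [IsProbabilityMeasure B]
    (hB : B (Icc a b)ᶜ = 0) (hat : ∀ x, B {x} = 0) {r t : ℝ} (hr : suppInf B ≤ r) :
    condMeanBelow B t ≤ r ↔ ∫ m in Iic t, (m - r) ∂B ≤ 0 := by
  by_cases h : B (Iic t) = 0
  · have ht := (measure_Iic_eq_zero_iff hB hat).1 h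
    simp [condMeanBelow, h, Measure.restrict_eq_zero.2 h, ht.trans hr]
  · rw [condMeanBelow, if_neg h, poolMean_le_iff hB h]

theorem maxCutoff_eq {a b : ℝ} {B : Measure ℝ} [IsProbabilityMeasure B]
    (hB : B (Icc a b)ᶜ = 0) (hat : ∀ x, B {x} = 0) {r : ℝ} (hr : suppInf B ≤ r) :
    maxCutoff r B =
      sSup (Icc (suppInf B) (suppSup B) ∩ {t | ∫ m in Iic t, (m - r) ∂B ≤ 0}) := by
  rw [maxCutoff]
  congr 1
  ext t
  simp only [mem_ofPred_eq, mem_inter_iff, condMeanBelow_le_iff hB hat hr]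

open Classical in
/-- The largest threshold below which types can be pooled without making the agent stop: `x̄` if
`r` is in the hull of the support, and `r` itself otherwise. With the latter choice the loss
formula for `Z_B` also gives the loss on `Z_A`, and no loss if `r` exceeds the support. -/
noncomputable def cutoff (r : ℝ) (B : Measure ℝ) : ℝ :=
  if r ∈ Icc (suppInf B) (suppSup B) then maxCutoff r B else r

theorem maxCutoff_mem {a b : ℝ} {B : Measure ℝ} [IsProbabilityMeasure B]
    (hB : B (Icc a b)ᶜ = 0) (hat : ∀ x, B {x} = 0) {r : ℝ}
    (hr : r ∈ Icc (suppInf B) (suppSup B)) :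
    maxCutoff r B ∈ Icc (suppInf B) (suppSup B) ∩ {t | ∫ m in Iic t, (m - r) ∂B ≤ 0} := by
  rw [maxCutoff_eq hB hat hr.1]
  refine (isCompact_Icc.inter_right ?_).sSup_mem ⟨r, hr, setIntegral_Iic_self_nonpos B r⟩
  exact isClosed_le (continuous_setIntegral_Iic_sub hB hat r) continuous_const

theorem le_maxCutoff {a b : ℝ} {B : Measure ℝ} [IsProbabilityMeasure B]
    (hB : B (Icc a b)ᶜ = 0) (hat : ∀ x, B {x} = 0) {r t : ℝ}
    (hr : r ∈ Icc (suppInf B) (suppSup B)) (ht : t ∈ Icc (suppInf B) (suppSup B))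
    (h : ∫ m in Iic t, (m - r) ∂B ≤ 0) : t ≤ maxCutoff r B := by
  rw [maxCutoff_eq hB hat hr.1]
  exact le_csSup (bddAbove_Icc.mono inter_subset_left) ⟨ht, h⟩

theorem le_cutoff {a b : ℝ} {B : Measure ℝ} [IsProbabilityMeasure B]
    (hB : B (Icc a b)ᶜ = 0) (hat : ∀ x, B {x} = 0) (r : ℝ) : r ≤ cutoff r B := by
  rw [cutoff]
  split_ifs with hr
  · exact le_maxCutoff hB hat hr hr (setIntegral_Iic_self_nonpos B r)
  · exact le_rfl

theorem setIntegral_Iic_cutoff_nonpos {a b : ℝ} {B : Measure ℝ} [IsProbabilityMeasure B]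
    (hB : B (Icc a b)ᶜ = 0) (hat : ∀ x, B {x} = 0) (r : ℝ) :
    ∫ m in Iic (cutoff r B), (m - r) ∂B ≤ 0 := by
  rw [cutoff]
  split_ifs with hr
  · exact (maxCutoff_mem hB hat hr).2
  · exact setIntegral_Iic_self_nonpos B r

/-- Either all types can be pooled, or the incentive constraint binds at the cutoff. -/
theorem cdf_cutoff_eq_one_or {a b : ℝ} {B : Measure ℝ} [IsProbabilityMeasure B]
    (hB : B (Icc a b)ᶜ = 0) (hat : ∀ x, B {x} = 0) (r : ℝ) :
    cdf B (cutoff r B) = 1 ∨ ∫ m in Iic (cutoff r B), (m - r) ∂B = 0 := by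
  rw [cutoff]
  split_ifs with hr
  · obtain ⟨⟨h1, h2⟩, h3⟩ := maxCutoff_mem hB hat hr
    rcases h2.eq_or_lt with h2 | h2
    · exact Or.inl (cdf_eq_one_of_suppSup_le hB h2.ge)
    · refine Or.inr (le_antisymm h3 (not_lt.1 fun h4 => ?_))
      -- by continuity a slightly larger threshold would satisfy the constraint as well
      have h5 := ((continuous_setIntegral_Iic_sub hB hat r).tendsto (maxCutoff r B)).eventually
        (gt_mem_nhds h4)
      obtain ⟨t, ht, ht1, ht2⟩ := ((h5.filter_mono nhdsWithin_le_nhds).and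
        (Ioo_mem_nhdsGT h2)).exists
      exact absurd (le_maxCutoff hB hat hr ⟨h1.trans ht1.le, ht2.le⟩ ht.le) (not_le.2 ht1)
  · rcases lt_or_ge r (suppInf B) with h | h
    · refine Or.inr ?_
      rw [Measure.restrict_eq_zero.2 ((measure_Iic_eq_zero_iff hB hat).2 h.le),
        integral_zero_measure]
    · exact Or.inl (cdf_eq_one_of_suppSup_le hB (not_le.1 fun h' => hr ⟨h, h'⟩).le)

/-! ### The optimal contract -/

/-- The surplus lost relative to efficient search when the cutoff of the efficient stopping rule
is `y` and the agent's reservation value is `r ≤ y`. -/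
noncomputable def loss (r : ℝ) (B : Measure ℝ) (y : ℝ) : ℝ :=
  ∫ m in r..y, max (cdf B m - cdf B (cutoff r B)) 0

theorem monotone_lossDensity (r : ℝ) (B : Measure ℝ) :
    Monotone fun m => max (cdf B m - cdf B (cutoff r B)) 0 := fun _ _ h =>
  max_le_max (sub_le_sub_right (monotone_cdf B h) _) le_rfl

theorem loss_nonneg {r y : ℝ} (B : Measure ℝ) (hy : r ≤ y) : 0 ≤ loss r B y :=
  intervalIntegral.integral_nonneg hy fun _ _ => le_max_right _ _

theorem loss_self (r : ℝ) (B : Measure ℝ) : loss r B r = 0 :=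
  intervalIntegral.integral_same

theorem loss_sub_loss (r : ℝ) (B : Measure ℝ) (x y : ℝ) :
    loss r B y - loss r B x = ∫ m in x..y, max (cdf B m - cdf B (cutoff r B)) 0 := by
  rw [loss, loss, intervalIntegral.integral_interval_sub_left] <;>
  exact (monotone_lossDensity r B).intervalIntegrable

theorem loss_mono (r : ℝ) (B : Measure ℝ) : Monotone (loss r B) := fun x y h => by
  have := loss_sub_loss r B x y
  have : 0 ≤ ∫ m in x..y, max (cdf B m - cdf B (cutoff r B)) 0 :=
    intervalIntegral.integral_nonneg h fun _ _ => le_max_right _ _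
  linarith

theorem abs_loss_sub_loss_le (r : ℝ) (B : Measure ℝ) (x y : ℝ) :
    |loss r B y - loss r B x| ≤ |y - x| := by
  rw [loss_sub_loss, ← Real.norm_eq_abs, ← one_mul |y - x|]
  refine intervalIntegral.norm_integral_le_of_norm_le_const fun m _ => ?_
  rw [Real.norm_eq_abs, abs_of_nonneg (le_max_right _ _)]
  exact max_le (by linarith [cdf_le_one B m, cdf_nonneg B (cutoff r B)]) zero_le_one

theorem loss_eq_zero {r y : ℝ} {B : Measure ℝ} (hy : r ≤ y) (h : y ≤ cutoff r B) :
    loss r B y = 0 := by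
  refine (intervalIntegral.integral_congr (g := fun _ => 0) fun m hm => ?_).trans
    intervalIntegral.integral_zero
  rw [uIcc_of_le hy] at hm
  exact max_eq_right (sub_nonpos.2 (monotone_cdf B (hm.2.trans h)))

theorem loss_eq {r y : ℝ} {B : Measure ℝ} (hr : r ≤ cutoff r B) (h : cutoff r B ≤ y) :
    loss r B y = ∫ m in (cutoff r B)..y, (cdf B m - cdf B (cutoff r B)) := by
  have h1 := loss_sub_loss r B (cutoff r B) y
  rw [loss_eq_zero hr le_rfl, sub_zero] at h1
  rw [h1]
  refine intervalIntegral.integral_congr fun m hm => ?_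
  rw [uIcc_of_le h] at hm
  exact max_eq_left (sub_nonneg.2 (monotone_cdf B hm.1))

theorem loss_eq_incBenefit {r y : ℝ} (b : ℝ) {B : Measure ℝ} (hr : r ≤ cutoff r B)
    (h : cutoff r B ≤ y) : loss r B y = (y - cutoff r B) * (1 - cdf B (cutoff r B))
      + incBenefit b B y - incBenefit b B (cutoff r B) := by
  have h1 := incBenefit_sub_incBenefit b B (cutoff r B) y
  rw [intervalIntegral.integral_sub intervalIntegrable_const (intervalIntegrable_cdf _ _ _)] at h1
  rw [loss_eq hr h, intervalIntegral.integral_sub (intervalIntegrable_cdf _ _ _)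
    intervalIntegrable_const]
  simp only [intervalIntegral.integral_const, smul_eq_mul] at h1 ⊢
  linarith

/-- If the incentive constraint binds at `X`, no contraction makes the agent continue so often that
the surplus exceeds the one from pooling below `X`. -/
theorem surplus_le_of_binding {a b : ℝ} {B H : Measure ℝ} [IsProbabilityMeasure B]
    (hB : B (Icc a b)ᶜ = 0) {r w X : ℝ} (har : a ≤ r) (hrX : r ≤ X) (hXw : X ≤ r + w)
    (hX : ∫ m in Iic X, (m - r) ∂B = 0) (hH : H ∈ contractions a b B) :
    incBenefit b H r + cdf H r * w ≤ mean B - r + cdf B X * w := by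
  have hHp := hH.1
  rw [setIntegral_Iic_sub hB] at hX
  have h0 := mean_sub_le_incBenefit hH.2.1 r
  rw [mean_eq_of_mem_contractions hB hH] at h0
  have key : ∀ x, r ≤ x →
      incBenefit b H r ≤ incBenefit b B x + (x - r) * (1 - cdf H r) := fun x hx =>
    (incBenefit_le_add b H hx).trans
      (by linarith [incBenefit_le_of_mem_contractions hB hH (har.trans hx)])
  rcases hrX.eq_or_lt with rfl | hlt
  · have h1 := key r le_rfl
    have h2 : cdf H r ≤ cdf B r := by
      -- compare slopes on `[r, x]` and let `x` decrease to `r`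
      refine ge_of_tendsto (((cdf B).right_continuous r).mono Ioi_subset_Ici_self) ?_
      filter_upwards [self_mem_nhdsWithin] with x hx
      have hx' : r < x := hx
      have h3 := key x hx'.le
      have h4 := incBenefit_add_le b B hx'.le
      have h5 : (x - r) * cdf H r ≤ (x - r) * cdf B x := by linarith
      exact le_of_mul_le_mul_left h5 (sub_pos.2 hx')
    have h3 := mul_le_mul_of_nonneg_right h2 (show 0 ≤ w by linarith)
    linarith
  · have h1 := key X hrX
    have hp : 0 < X - r := sub_pos.2 hlt
    have h2 : (X - r) * (cdf B X - cdf H r) ≥ incBenefit b H r - mean B + r := by linarith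
    have h3 : 0 ≤ cdf B X - cdf H r :=
      nonneg_of_mul_nonneg_right (by linarith) hp
    have h4 : (X - r) * (cdf B X - cdf H r) ≤ w * (cdf B X - cdf H r) :=
      mul_le_mul_of_nonneg_right (by linarith) h3
    linarith

/-- The surplus that a contraction generates when the principal's continuation value is `w` is at
most the efficient surplus minus the loss. -/
theorem surplus_le {a b : ℝ} {B H : Measure ℝ} [IsProbabilityMeasure B]
    (hB : B (Icc a b)ᶜ = 0) (hat : ∀ x, B {x} = 0) {r w : ℝ} (har : a ≤ r) (hw : 0 ≤ w)
    (hH : H ∈ contractions a b B) :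
    incBenefit b H r + cdf H r * w ≤ w + incBenefit b B (r + w) - loss r B (r + w) := by
  have hHp := hH.1
  have hX := le_cutoff hB hat r
  have h1 := incBenefit_le_add b H (show r ≤ r + w by linarith)
  have h2 := incBenefit_le_of_mem_contractions hB hH (show a ≤ r + w by linarith)
  rcases le_total (r + w) (cutoff r B) with h | h
  · rw [loss_eq_zero (by linarith) h]
    linarith
  · rw [loss_eq_incBenefit b hX h]
    rcases cdf_cutoff_eq_one_or hB hat r with h3 | h3
    · rw [h3]
      have h4 := incBenefit_add_le b B h
      have h5 := mul_nonneg (sub_nonneg.2 h) (sub_nonneg.2 (cdf_le_one B (r + w)))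
      linarith
    · have h4 := surplus_le_of_binding hB har hX h h3 hH
      rw [setIntegral_Iic_sub hB] at h3
      linarith

/-- Pooling below the smaller of the cutoff and the efficient stopping threshold attains the
maximal surplus. -/
theorem surplus_poolBelow {a b : ℝ} {B : Measure ℝ} [IsProbabilityMeasure B]
    (hB : B (Icc a b)ᶜ = 0) (hat : ∀ x, B {x} = 0) {r w : ℝ} (hw : 0 ≤ w) :
    incBenefit b (poolBelow (min (cutoff r B) (r + w)) B) r
      + cdf (poolBelow (min (cutoff r B) (r + w)) B) r * w =
      w + incBenefit b B (r + w) - loss r B (r + w) := by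
  have hX := le_cutoff hB hat r
  have hrt : r ≤ min (cutoff r B) (r + w) := le_min hX (by linarith)
  have h : B (Iic (min (cutoff r B) (r + w))) ≠ 0 →
      (∫ θ in Iic (min (cutoff r B) (r + w)), θ ∂B) /
        B.real (Iic (min (cutoff r B) (r + w))) ≤ r := fun h0 =>
    (poolMean_le_iff hB h0).2 ((setIntegral_Iic_sub_mono hB hrt (min_le_left _ _)).trans
      (setIntegral_Iic_cutoff_nonpos hB hat r))
  rw [cdf_poolBelow hrt h, incBenefit_poolBelow hB hrt h]
  rcases le_total (r + w) (cutoff r B) with h | h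
  · rw [min_eq_right h, loss_eq_zero (by linarith) h]
    ring
  · rw [min_eq_left h, loss_eq_incBenefit b hX h]
    ring

/-! ### The agent's search problem -/

theorem searchPayoff_eq_of_solves {a b δ u : ℝ} (hδ0 : 0 < δ) (hδ1 : δ < 1) {G : Measure ℝ}
    [IsProbabilityMeasure G] (hG : G (Icc a b)ᶜ = 0) (hu : SolvesSearch δ G u) :
    u = searchPayoff δ G :=
  (existsUnique_solvesSearch hδ0 hδ1 G hG).unique hu (searchPayoff_spec hδ0 hδ1 G hG)

theorem searchPayoff_eq {a b δ : ℝ} (hδ0 : 0 < δ) (hδ1 : δ < 1) {G : Measure ℝ}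
    [IsProbabilityMeasure G] (hG : G (Icc a b)ᶜ = 0) :
    searchPayoff δ G = reservation δ G + incBenefit b G (reservation δ G) := by
  have h : searchPayoff δ G = ∫ m, max m (δ * searchPayoff δ G) ∂G :=
    searchPayoff_spec hδ0 hδ1 G hG
  rwa [integral_max_eq hG] at h

theorem mean_le_searchPayoff {a b δ : ℝ} (hδ0 : 0 < δ) (hδ1 : δ < 1) {G : Measure ℝ}
    [IsProbabilityMeasure G] (hG : G (Icc a b)ᶜ = 0) : mean G ≤ searchPayoff δ G := by
  linarith [searchPayoff_eq hδ0 hδ1 hG, mean_sub_le_incBenefit hG (reservation δ G)]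

theorem le_searchPayoff {a b δ u : ℝ} (hδ0 : 0 < δ) (hδ1 : δ < 1) {G : Measure ℝ}
    [IsProbabilityMeasure G] (hG : G (Icc a b)ᶜ = 0)
    (hu : u ≤ δ * u + incBenefit b G (δ * u)) : u ≤ searchPayoff δ G := by
  by_contra hlt
  rw [not_le] at hlt
  have h1 := searchPayoff_eq hδ0 hδ1 hG
  rw [reservation] at h1
  have h2 : δ * searchPayoff δ G ≤ δ * u := mul_le_mul_of_nonneg_left hlt.le hδ0.le
  have h3 := incBenefit_add_le b G h2
  have h4 := mul_nonneg (sub_nonneg.2 h2) (sub_nonneg.2 (cdf_le_one G (δ * u)))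
  have h5 : (1 - δ) * searchPayoff δ G < (1 - δ) * u :=
    mul_lt_mul_of_pos_left hlt (by linarith)
  linarith

section PublicSignal

variable {Z : Type*} [MeasurableSpace Z]

/-! ### Averaging over the public signal -/

theorem IsBayesPosterior.snd_eq {F : Measure ℝ} [IsProbabilityMeasure F] {ξ : Kernel ℝ Z}
    [IsMarkovKernel ξ] {β : Kernel Z ℝ} (h : IsBayesPosterior F ξ β) :
    ((F.bind ξ) ⊗ₘ β).snd = F := by
  rw [← h, Measure.snd_map_swap, Measure.fst_compProd]

theorem integral_posterior {F : Measure ℝ} {ν : Measure Z} [IsProbabilityMeasure ν]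
    {β : Kernel Z ℝ} [IsMarkovKernel β] (hF : (ν ⊗ₘ β).snd = F) {f : ℝ → ℝ}
    (hf : Integrable f F) :
    Integrable (fun z => ∫ m, f m ∂(β z)) ν ∧ ∫ z, ∫ m, f m ∂(β z) ∂ν = ∫ m, f m ∂F := by
  subst hF
  have hf' : Integrable (fun q : Z × ℝ => f q.2) (ν ⊗ₘ β) := by
    rw [Measure.snd] at hf
    exact hf.comp_measurable measurable_snd
  refine ⟨Integrable.integral_compProd (κ := Kernel.const Unit ν) (η := Kernel.prodMkLeft Unit β)
    (a := ()) hf', ?_⟩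
  rw [← Measure.integral_compProd hf', Measure.snd,
    integral_map measurable_snd.aemeasurable]
  rw [Measure.snd] at hf
  exact hf.aestronglyMeasurable

theorem measurable_mean (β : Kernel Z ℝ) [IsMarkovKernel β] :
    Measurable fun z => mean (β z) :=
  (StronglyMeasurable.integral_kernel (κ := β) stronglyMeasurable_id).measurable

theorem isProbabilityMeasure_posteriorMeanLaw (ν : Measure Z) [IsProbabilityMeasure ν]
    (β : Kernel Z ℝ) [IsMarkovKernel β] : IsProbabilityMeasure (posteriorMeanLaw ν β) :=
  Measure.isProbabilityMeasure_map (measurable_mean β).aemeasurable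

theorem posteriorMeanLaw_compl_Icc {a b : ℝ} (ν : Measure Z) {β : Kernel Z ℝ}
    [IsMarkovKernel β] (hβ : ∀ z, β z (Icc a b)ᶜ = 0) :
    posteriorMeanLaw ν β (Icc a b)ᶜ = 0 := by
  rw [posteriorMeanLaw, Measure.map_apply (measurable_mean β) measurableSet_Icc.compl]
  convert measure_empty (μ := ν)
  ext z
  simpa using mean_mem_Icc (hβ z)

theorem integral_posteriorMeanLaw {ν : Measure Z} {β : Kernel Z ℝ}
    [IsMarkovKernel β] {f : ℝ → ℝ} (hf : Measurable f) :
    ∫ m, f m ∂(posteriorMeanLaw ν β) = ∫ z, f (mean (β z)) ∂ν :=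
  integral_map (measurable_mean β).aemeasurable hf.aestronglyMeasurable

theorem integrable_posPart_mean {a b : ℝ} (ν : Measure Z) [IsProbabilityMeasure ν]
    {β : Kernel Z ℝ} [IsMarkovKernel β] (hβ : ∀ z, β z (Icc a b)ᶜ = 0) (x : ℝ) :
    Integrable (fun z => max (mean (β z) - x) 0) ν := by
  have := isProbabilityMeasure_posteriorMeanLaw ν β
  exact (integrable_posPart_of_Icc (posteriorMeanLaw_compl_Icc ν hβ) x).comp_measurable
    (measurable_mean β)

theorem integral_posPart_mean {a b : ℝ} (ν : Measure Z) [IsProbabilityMeasure ν]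
    {β : Kernel Z ℝ} [IsMarkovKernel β] (hβ : ∀ z, β z (Icc a b)ᶜ = 0) (x : ℝ) :
    ∫ z, max (mean (β z) - x) 0 ∂ν = incBenefit b (posteriorMeanLaw ν β) x := by
  have := isProbabilityMeasure_posteriorMeanLaw ν β
  rw [incBenefit_eq_integral (posteriorMeanLaw_compl_Icc ν hβ),
    integral_posteriorMeanLaw (by fun_prop)]

theorem integral_incBenefit {a b : ℝ} {F : Measure ℝ} [IsProbabilityMeasure F]
    (hFΘ : F (Icc a b)ᶜ = 0) {ν : Measure Z} [IsProbabilityMeasure ν]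
    {β : Kernel Z ℝ} [IsMarkovKernel β] (hβ : ∀ z, β z (Icc a b)ᶜ = 0)
    (hF : (ν ⊗ₘ β).snd = F) (x : ℝ) :
    Integrable (fun z => incBenefit b (β z) x) ν ∧
      ∫ z, incBenefit b (β z) x ∂ν = incBenefit b F x := by
  have h := integral_posterior hF (integrable_posPart_of_Icc hFΘ x)
  simp only [← fun z => incBenefit_eq_integral (hβ z) x, ← incBenefit_eq_integral hFΘ x] at h
  exact h

theorem mean_posteriorMeanLaw {a b : ℝ} {F : Measure ℝ} [IsProbabilityMeasure F]
    (hFΘ : F (Icc a b)ᶜ = 0) {ν : Measure Z} [IsProbabilityMeasure ν]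
    {β : Kernel Z ℝ} [IsMarkovKernel β] (hF : (ν ⊗ₘ β).snd = F) :
    mean (posteriorMeanLaw ν β) = mean F := by
  rw [mean, integral_posteriorMeanLaw measurable_id']
  exact (integral_posterior hF (integrable_id_of_Icc hFΘ)).2

/-- Coarser information lowers the value of search (conditional Jensen). -/
theorem searchPayoff_posteriorMeanLaw_le {a b δ : ℝ} (hδ0 : 0 < δ) (hδ1 : δ < 1)
    {F : Measure ℝ} [IsProbabilityMeasure F]
    (hFΘ : F (Icc a b)ᶜ = 0) {ν : Measure Z} [IsProbabilityMeasure ν]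
    {β : Kernel Z ℝ} [IsMarkovKernel β] (hβ : ∀ z, β z (Icc a b)ᶜ = 0)
    (hF : (ν ⊗ₘ β).snd = F) :
    searchPayoff δ (posteriorMeanLaw ν β) ≤ searchPayoff δ F := by
  have := isProbabilityMeasure_posteriorMeanLaw ν β
  have h1 := searchPayoff_eq hδ0 hδ1 (posteriorMeanLaw_compl_Icc ν hβ)
  rw [reservation] at h1
  refine le_searchPayoff hδ0 hδ1 hFΘ ?_
  set x := δ * searchPayoff δ (posteriorMeanLaw ν β)
  obtain ⟨h2, h3⟩ := integral_incBenefit hFΘ hβ hF x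
  have h4 : ∫ z, max (mean (β z) - x) 0 ∂ν ≤ ∫ z, incBenefit b (β z) x ∂ν :=
    integral_mono (integrable_posPart_mean ν hβ x) h2 fun z =>
      max_le (mean_sub_le_incBenefit (hβ z) x) (incBenefit_nonneg (hβ z) x)
  rw [integral_posPart_mean ν hβ, h3] at h4
  linarith

/-! ### Measurability in the public signal -/

theorem measurable_cdf_kernel (β : Kernel Z ℝ) [IsMarkovKernel β] :
    Measurable fun q : Z × ℝ => cdf (β q.1) q.2 := by
  simp only [cdf_eq_real, measureReal_def]
  refine Measurable.ennreal_toReal ?_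
  exact Kernel.measurable_kernel_prodMk_left (κ := Kernel.prodMkRight ℝ β)
    (t := {q : (Z × ℝ) × ℝ | q.2 ≤ q.1.2})
    (measurableSet_le measurable_snd (measurable_snd.comp measurable_fst))

theorem measurable_suppInf {a b : ℝ} {β : Kernel Z ℝ} [IsMarkovKernel β]
    (hβ : ∀ z, β z (Icc a b)ᶜ = 0) : Measurable fun z => suppInf (β z) := by
  refine measurable_of_Ici fun t => ?_
  have h : (fun z => suppInf (β z)) ⁻¹' Ici t = (fun z => β z (Iio t)) ⁻¹' {0} := by
    ext z
    exact le_suppInf_iff (hβ z)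
  rw [h]
  exact β.measurable_coe measurableSet_Iio (measurableSet_singleton 0)

theorem measurable_suppSup {a b : ℝ} {β : Kernel Z ℝ} [IsMarkovKernel β]
    (hβ : ∀ z, β z (Icc a b)ᶜ = 0) : Measurable fun z => suppSup (β z) := by
  refine measurable_of_Iic fun t => ?_
  have h : (fun z => suppSup (β z)) ⁻¹' Iic t = (fun z => β z (Ioi t)) ⁻¹' {0} := by
    ext z
    exact suppSup_le_iff (hβ z)
  rw [h]
  exact β.measurable_coe measurableSet_Ioi (measurableSet_singleton 0)

theorem cutoff_lt_iff {a b : ℝ} {B : Measure ℝ} [IsProbabilityMeasure B]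
    (hB : B (Icc a b)ᶜ = 0) (hat : ∀ x, B {x} = 0) {r t : ℝ} (hrt : r < t) :
    cutoff r B < t ↔ r < suppInf B ∨ suppSup B < t ∨ 0 < ∫ m in Iic t, (m - r) ∂B := by
  by_cases hr : r ∈ Icc (suppInf B) (suppSup B)
  · rw [cutoff, if_pos hr]
    obtain ⟨⟨h1, h2⟩, h3⟩ := maxCutoff_mem hB hat hr
    constructor
    · intro h
      by_contra! hcon
      exact absurd (le_maxCutoff hB hat hr ⟨hr.1.trans hrt.le, hcon.2.1⟩ hcon.2.2)
        (not_le.2 h)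
    · rintro (h | h | h)
      · exact absurd hr.1 (not_le.2 h)
      · exact h2.trans_lt h
      · by_contra! hcon
        exact absurd ((setIntegral_Iic_sub_mono hB hrt.le hcon).trans h3) (not_le.2 h)
  · rw [cutoff, if_neg hr]
    refine ⟨fun _ => ?_, fun _ => hrt⟩
    by_contra! hcon
    exact hr ⟨hcon.1, hrt.le.trans hcon.2.1⟩

theorem measurable_cutoff {a b : ℝ} {β : Kernel Z ℝ} [IsMarkovKernel β]
    (hβ : ∀ z, β z (Icc a b)ᶜ = 0) (hat : ∀ z x, β z {x} = 0) (r : ℝ) :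
    Measurable fun z => cutoff r (β z) := by
  refine measurable_of_Iio fun t => ?_
  rcases le_or_gt t r with htr | hrt
  · convert MeasurableSet.empty (α := Z)
    ext z
    simpa using htr.trans (le_cutoff (hβ z) (hat z) r)
  · have h : (fun z => cutoff r (β z)) ⁻¹' Iio t = {z | r < suppInf (β z)} ∪
        ({z | suppSup (β z) < t} ∪ {z | 0 < ∫ m, (Iic t).indicator (fun m => m - r) m ∂(β z)}) := by
      ext z
      simp only [integral_indicator measurableSet_Iic]
      exact cutoff_lt_iff (hβ z) (hat z) hrt
    rw [h]
    have h1 : Measurable fun z => ∫ m, (Iic t).indicator (fun m => m - r) m ∂(β z) :=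
      (StronglyMeasurable.integral_kernel (κ := β)
        ((stronglyMeasurable_id.sub stronglyMeasurable_const).indicator
          measurableSet_Iic)).measurable
    exact (measurableSet_lt measurable_const (measurable_suppInf hβ)).union
      ((measurableSet_lt (measurable_suppSup hβ) measurable_const).union
        (measurableSet_lt measurable_const h1))

theorem measurable_loss {a b : ℝ} {β : Kernel Z ℝ} [IsMarkovKernel β]
    (hβ : ∀ z, β z (Icc a b)ᶜ = 0) (hat : ∀ z x, β z {x} = 0) (r y : ℝ) :
    Measurable fun z => loss r (β z) y := by
  have h1 := measurable_cdf_kernel β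
  have h2 : Measurable fun q : Z × ℝ => cdf (β q.1) (cutoff r (β q.1)) :=
    h1.comp (measurable_fst.prodMk ((measurable_cutoff hβ hat r).comp measurable_fst))
  have h3 : StronglyMeasurable (Function.uncurry fun (z : Z) (m : ℝ) =>
      max (cdf (β z) m - cdf (β z) (cutoff r (β z))) 0) :=
    ((h1.sub h2).max measurable_const).stronglyMeasurable
  simp only [loss, intervalIntegral]
  exact (h3.integral_prod_right.sub h3.integral_prod_right).measurable

theorem integrable_loss {a b : ℝ} (ν : Measure Z) [IsProbabilityMeasure ν]
    {β : Kernel Z ℝ} [IsMarkovKernel β]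
    (hβ : ∀ z, β z (Icc a b)ᶜ = 0) (hat : ∀ z x, β z {x} = 0) (r y : ℝ) :
    Integrable (fun z => loss r (β z) y) ν := by
  refine Integrable.of_bound (C := |y - r|) (measurable_loss hβ hat r y).aestronglyMeasurable
    (Filter.Eventually.of_forall fun z => ?_)
  have h := abs_loss_sub_loss_le r (β z) r y
  rwa [loss_self, sub_zero] at h

theorem measurableSet_setA {a b : ℝ} {β : Kernel Z ℝ} [IsMarkovKernel β]
    (hβ : ∀ z, β z (Icc a b)ᶜ = 0) (r : ℝ) : MeasurableSet (setA r β) :=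
  measurableSet_lt measurable_const (measurable_suppInf hβ)

theorem setB_eq (r rbar : ℝ) (β : Kernel Z ℝ) (k : ℝ) :
    setB r rbar β k =
      {z | r ∈ Icc (suppInf (β z)) (suppSup (β z)) ∧ cutoff r (β z) < rbar - k} := by
  ext z
  refine and_congr_right fun h => ?_
  rw [cutoff, if_pos h]

theorem measurableSet_setB {a b : ℝ} {β : Kernel Z ℝ} [IsMarkovKernel β]
    (hβ : ∀ z, β z (Icc a b)ᶜ = 0) (hat : ∀ z x, β z {x} = 0) (r rbar k : ℝ) :
    MeasurableSet (setB r rbar β k) := by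
  rw [setB_eq]
  exact ((measurableSet_le (measurable_suppInf hβ) measurable_const).inter
    (measurableSet_le measurable_const (measurable_suppSup hβ))).inter
    (measurableSet_lt (measurable_cutoff hβ hat r) measurable_const)

/-! ### The function `Φ` -/

theorem loss_eq_of_mem_setA {a b : ℝ} {β : Kernel Z ℝ} [IsMarkovKernel β]
    (hβ : ∀ z, β z (Icc a b)ᶜ = 0) (hat : ∀ z x, β z {x} = 0) {r y : ℝ} {z : Z}
    (hz : z ∈ setA r β) : loss r (β z) y = ∫ m in r..y, cdf (β z) m := by
  have hz' : r < suppInf (β z) := hz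
  have h0 : cutoff r (β z) = r := if_neg fun h => absurd h.1 (not_le.2 hz')
  have h1 : cdf (β z) r = 0 := by
    rw [cdf_eq_real, measureReal_def, (measure_Iic_eq_zero_iff (hβ z) (hat z)).2 hz'.le,
      ENNReal.toReal_zero]
  simp only [loss, h0, h1, sub_zero, max_eq_left (cdf_nonneg _ _)]

theorem loss_eq_zero_of_notMem {a b : ℝ} {β : Kernel Z ℝ} [IsMarkovKernel β]
    (hβ : ∀ z, β z (Icc a b)ᶜ = 0) {r rbar k : ℝ} (hk : r ≤ rbar - k)
    {z : Z} (hz : z ∉ setA r β ∪ setB r rbar β k) : loss r (β z) (rbar - k) = 0 := by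
  rw [setB_eq] at hz
  have hA : suppInf (β z) ≤ r := not_lt.1 fun h => hz (Or.inl h)
  rcases le_or_gt r (suppSup (β z)) with h | h
  · exact loss_eq_zero hk (not_lt.1 fun h' => hz (Or.inr ⟨⟨hA, h⟩, h'⟩))
  · have h0 : cutoff r (β z) = r := if_neg fun h' => absurd h'.2 (not_le.2 h)
    have h1 := cdf_eq_one_of_suppSup_le (hβ z) h.le
    simp only [loss, h0, h1, max_eq_right (sub_nonpos.2 (cdf_le_one _ _)),
      intervalIntegral.integral_zero]

/-- As long as the efficient cutoff `rbar - k` is not below `r`, `Φ` is the expected loss net of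
the gain in incremental benefits. -/
theorem Phi_eq {a b : ℝ} (F : Measure ℝ) {ν : Measure Z} [IsProbabilityMeasure ν]
    {β : Kernel Z ℝ} [IsMarkovKernel β]
    (hβ : ∀ z, β z (Icc a b)ᶜ = 0) (hat : ∀ z x, β z {x} = 0) {r rbar k : ℝ}
    (hk : r ≤ rbar - k) :
    Phi F ν β r rbar k = incBenefit b F rbar - incBenefit b F (rbar - k)
      + ∫ z, loss r (β z) (rbar - k) ∂ν := by
  have hA := measurableSet_setA hβ r
  have hB := measurableSet_setB hβ hat r rbar k
  have hint := integrable_loss ν hβ hat r (rbar - k)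
  have h1 : ∫ z in setA r β, (∫ m in r..(rbar - k), cdf (β z) m) ∂ν =
      ∫ z in setA r β, loss r (β z) (rbar - k) ∂ν :=
    setIntegral_congr_fun hA fun z hz => (loss_eq_of_mem_setA hβ hat hz).symm
  have h2 : ∫ z in setB r rbar β k, (∫ m in (maxCutoff r (β z))..(rbar - k),
        (cdf (β z) m - cdf (β z) (maxCutoff r (β z)))) ∂ν =
      ∫ z in setB r rbar β k, loss r (β z) (rbar - k) ∂ν := by
    refine setIntegral_congr_fun hB fun z hz => ?_
    have h3 : cutoff r (β z) = maxCutoff r (β z) := if_pos hz.1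
    have h4 := loss_eq (le_cutoff (hβ z) (hat z) r) (h3.trans_le hz.2.le)
    rw [h3] at h4
    exact h4.symm
  have hdisj : Disjoint (setA r β) (setB r rbar β k) :=
    disjoint_left.2 fun z h h' => absurd h'.1.1 (not_le.2 h)
  rw [Phi, h1, h2, add_assoc, ← setIntegral_union hdisj hB hint.integrableOn hint.integrableOn,
    setIntegral_eq_integral_of_forall_compl_eq_zero
      fun z hz => loss_eq_zero_of_notMem hβ hk hz, ← incBenefit_sub_incBenefit b]
  ring

/-- Beyond `rbar - r` the last two terms of `Φ` vanish. -/
theorem Phi_nonpos {a b : ℝ} (F : Measure ℝ) (ν : Measure Z)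
    {β : Kernel Z ℝ} [IsMarkovKernel β]
    (hβ : ∀ z, β z (Icc a b)ᶜ = 0) (hat : ∀ z x, β z {x} = 0) {r rbar k : ℝ}
    (hk0 : 0 ≤ k) (hk : rbar - k ≤ r) : Phi F ν β r rbar k ≤ 0 := by
  have h1 : ∫ z in setA r β, (∫ m in r..(rbar - k), cdf (β z) m) ∂ν = 0 := by
    refine setIntegral_eq_zero_of_forall_eq_zero fun z hz => ?_
    refine (intervalIntegral.integral_congr (g := fun _ => 0) fun m hm => ?_).trans
      intervalIntegral.integral_zero
    rw [uIcc_of_ge hk] at hm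
    have h2 : m ≤ suppInf (β z) := hm.2.trans (le_of_lt hz)
    simp only [cdf_eq_real, measureReal_def, (measure_Iic_eq_zero_iff (hβ z) (hat z)).2 h2,
      ENNReal.toReal_zero]
  have h2 : setB r rbar β k = ∅ := by
    rw [setB_eq]
    ext z
    simp only [mem_ofPred_eq, mem_empty_iff_false, iff_false, not_and, not_lt]
    exact fun _ => hk.trans (le_cutoff (hβ z) (hat z) r)
  have h3 : 0 ≤ ∫ m in (rbar - k)..rbar, (1 - cdf F m) :=
    intervalIntegral.integral_nonneg (by linarith) fun m _ => sub_nonneg.2 (cdf_le_one F m)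
  rw [Phi, h1, h2, setIntegral_empty]
  linarith

theorem Phi_antitoneOn {a b : ℝ} (F : Measure ℝ) {ν : Measure Z} [IsProbabilityMeasure ν]
    {β : Kernel Z ℝ} [IsMarkovKernel β]
    (hβ : ∀ z, β z (Icc a b)ᶜ = 0) (hat : ∀ z x, β z {x} = 0) {r rbar : ℝ} :
    AntitoneOn (Phi F ν β r rbar) (Iic (rbar - r)) := by
  intro k hk l hl hkl
  have hk' : k ≤ rbar - r := hk
  have hl' : l ≤ rbar - r := hl
  rw [Phi_eq F hβ hat (by linarith), Phi_eq F hβ hat (by linarith)]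
  have h1 : ∫ z, loss r (β z) (rbar - l) ∂ν ≤ ∫ z, loss r (β z) (rbar - k) ∂ν :=
    integral_mono (integrable_loss ν hβ hat r _) (integrable_loss ν hβ hat r _)
      fun z => loss_mono r (β z) (by linarith)
  have h2 : rbar - l ≤ rbar - k := by linarith
  have h3 := incBenefit_add_le b F h2
  have h4 := mul_nonneg (sub_nonneg.2 h2) (sub_nonneg.2 (cdf_le_one F (rbar - k)))
  linarith

theorem continuous_integral_loss {a b : ℝ} (ν : Measure Z) [IsProbabilityMeasure ν]
    {β : Kernel Z ℝ} [IsMarkovKernel β]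
    (hβ : ∀ z, β z (Icc a b)ᶜ = 0) (hat : ∀ z x, β z {x} = 0) (r : ℝ) :
    Continuous fun y => ∫ z, loss r (β z) y ∂ν := by
  refine (LipschitzWith.of_dist_le_mul (K := 1) fun x y => ?_).continuous
  rw [Real.dist_eq, Real.dist_eq, ← integral_sub (integrable_loss ν hβ hat r x)
    (integrable_loss ν hβ hat r y)]
  have h := norm_integral_le_of_norm_le_const (μ := ν) (C := |x - y|)
    (f := fun z => loss r (β z) x - loss r (β z) y)
    (Filter.Eventually.of_forall fun z => abs_loss_sub_loss_le r (β z) y x)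
  rwa [probReal_univ, mul_one, ← one_mul |x - y|] at h

theorem Phi_continuousOn {a b : ℝ} (F : Measure ℝ) {ν : Measure Z} [IsProbabilityMeasure ν]
    {β : Kernel Z ℝ} [IsMarkovKernel β]
    (hβ : ∀ z, β z (Icc a b)ᶜ = 0) (hat : ∀ z x, β z {x} = 0) {r rbar : ℝ} :
    ContinuousOn (Phi F ν β r rbar) (Iic (rbar - r)) := by
  have h1 := continuous_incBenefit b F
  have h2 := continuous_integral_loss ν hβ hat r
  have h3 : Continuous fun k => incBenefit b F rbar - incBenefit b F (rbar - k)
      + ∫ z, loss r (β z) (rbar - k) ∂ν :=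
    (continuous_const.sub (h1.comp (continuous_const.sub continuous_id))).add
      (h2.comp (continuous_const.sub continuous_id))
  refine h3.continuousOn.congr fun k hk => ?_
  have hk' : k ≤ rbar - r := hk
  exact Phi_eq F hβ hat (by linarith)

theorem Phi_zero_nonneg {a b : ℝ} (F : Measure ℝ) {ν : Measure Z} [IsProbabilityMeasure ν]
    {β : Kernel Z ℝ} [IsMarkovKernel β]
    (hβ : ∀ z, β z (Icc a b)ᶜ = 0) (hat : ∀ z x, β z {x} = 0) {r rbar : ℝ}
    (hr : r ≤ rbar) : 0 ≤ Phi F ν β r rbar 0 := by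
  rw [Phi_eq F hβ hat (by linarith), sub_zero, sub_self, zero_add]
  exact integral_nonneg fun z => loss_nonneg (β z) hr

theorem exists_eq_mul_Phi {a b c : ℝ} (F : Measure ℝ) {ν : Measure Z} [IsProbabilityMeasure ν]
    {β : Kernel Z ℝ} [IsMarkovKernel β]
    (hβ : ∀ z, β z (Icc a b)ᶜ = 0) (hat : ∀ z x, β z {x} = 0) {r rbar : ℝ}
    (hr : r ≤ rbar) (hc : 0 ≤ c) :
    ∃ k ∈ Icc 0 (rbar - r), k = c * Phi F ν β r rbar k := by
  have hcont : ContinuousOn (fun k => k - c * Phi F ν β r rbar k) (Icc 0 (rbar - r)) :=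
    continuousOn_id.sub (continuousOn_const.mul
      ((Phi_continuousOn F hβ hat).mono Icc_subset_Iic_self))
  have h0 := mul_nonneg hc (Phi_zero_nonneg (ν := ν) F hβ hat hr)
  have h1 := mul_nonpos_of_nonneg_of_nonpos hc
    (Phi_nonpos F ν hβ hat (sub_nonneg.2 hr) (by linarith : rbar - (rbar - r) ≤ r))
  obtain ⟨k, hk, hk0⟩ := intermediate_value_Icc (sub_nonneg.2 hr) hcont
    (show (0 : ℝ) ∈ _ from ⟨by linarith, by linarith⟩)
  exact ⟨k, hk, sub_eq_zero.1 hk0⟩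

/-- The equation for `k` has at most one solution on the whole line. -/
theorem eq_of_eq_mul_Phi {a b c : ℝ} (F : Measure ℝ) {ν : Measure Z} [IsProbabilityMeasure ν]
    {β : Kernel Z ℝ} [IsMarkovKernel β]
    (hβ : ∀ z, β z (Icc a b)ᶜ = 0) (hat : ∀ z x, β z {x} = 0) {r rbar : ℝ}
    (hr : r ≤ rbar) (hc : 0 ≤ c) {k l : ℝ} (hk : k = c * Phi F ν β r rbar k)
    (hl : l = c * Phi F ν β r rbar l) : k = l := by
  have hle : ∀ x, x = c * Phi F ν β r rbar x → x ≤ rbar - r := fun x hx => by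
    by_contra! h
    have h1 := mul_nonpos_of_nonneg_of_nonpos hc
      (Phi_nonpos F ν hβ hat (by linarith : 0 ≤ x) (by linarith : rbar - x ≤ r))
    linarith
  have key : ∀ x y, x = c * Phi F ν β r rbar x → y = c * Phi F ν β r rbar y → x ≤ y → y ≤ x := by
    intro x y hx hy hxy
    have h1 := mul_le_mul_of_nonneg_left
      (Phi_antitoneOn F hβ hat (ν := ν) (hle x hx) (hle y hy) hxy) hc
    linarith
  rcases le_total k l with h | h
  · exact le_antisymm h (key k l hk hl h)
  · exact le_antisymm (key l k hl hk h) h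

/-! ### Stationary equilibria -/

/-- The principal extracts the whole value of her information relative to no information. -/
theorem IsStationaryEquilibrium.price_eq {a b δ U V : ℝ} {ν : Measure Z} {β : Kernel Z ℝ}
    [IsMarkovKernel β] {p : Z → ℝ} {G : Z → Measure ℝ} (hβ : ∀ z, β z (Icc a b)ᶜ = 0)
    (hE : IsStationaryEquilibrium a b δ ν β U V p G) (z : Z) :
    p z = incBenefit b (G z) (δ * U) - incBenefit b (uninformative (β z)) (δ * U) := by
  refine le_antisymm (hE.accepted z) ?_
  have h := hE.optimal z _
    (sub_nonneg.2 (incBenefit_uninformative_le (hβ z) (hE.feasible z) (δ * U)))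
    (G z) (hE.feasible z) le_rfl
  rw [profit, profit] at h
  linarith

theorem integral_agentPayoff {a b : ℝ} (ν : Measure Z) [IsProbabilityMeasure ν] {β : Kernel Z ℝ}
    [IsMarkovKernel β] (hβ : ∀ z, β z (Icc a b)ᶜ = 0) (x : ℝ) :
    Integrable (fun z => x + incBenefit b (uninformative (β z)) x) ν ∧
      ∫ z, (x + incBenefit b (uninformative (β z)) x) ∂ν =
        x + incBenefit b (posteriorMeanLaw ν β) x := by
  have h := integrable_posPart_mean ν hβ x
  simp only [fun z => incBenefit_uninformative (hβ z) x]
  refine ⟨(integrable_const x).add h, ?_⟩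
  rw [integral_add (integrable_const x) h, integral_posPart_mean ν hβ]
  simp

theorem IsStationaryEquilibrium.agent_value_eq {a b δ U V : ℝ} (hδ0 : 0 < δ) (hδ1 : δ < 1)
    {ν : Measure Z} [IsProbabilityMeasure ν] {β : Kernel Z ℝ}
    [IsMarkovKernel β] {p : Z → ℝ} {G : Z → Measure ℝ} (hβ : ∀ z, β z (Icc a b)ᶜ = 0)
    (hE : IsStationaryEquilibrium a b δ ν β U V p G) :
    U = searchPayoff δ (posteriorMeanLaw ν β) := by
  have := isProbabilityMeasure_posteriorMeanLaw ν β
  have hG := posteriorMeanLaw_compl_Icc ν hβ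
  refine searchPayoff_eq_of_solves hδ0 hδ1 hG ?_
  rw [SolvesSearch, integral_max_eq hG, ← (integral_agentPayoff ν hβ (δ * U)).2]
  refine hE.agent_value.trans (integral_congr_ae (Filter.Eventually.of_forall fun z => ?_))
  simp only [agentPayoff, hE.price_eq hβ z]
  ring

/-- Offering no information for free keeps the principal's continuation value nonnegative. -/
theorem IsStationaryEquilibrium.principal_value_nonneg {a b δ U V : ℝ} (hδ0 : 0 < δ) (hδ1 : δ < 1)
    {ν : Measure Z} [IsProbabilityMeasure ν] {β : Kernel Z ℝ}
    [IsMarkovKernel β] {p : Z → ℝ} {G : Z → Measure ℝ} (hβ : ∀ z, β z (Icc a b)ᶜ = 0)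
    (hE : IsStationaryEquilibrium a b δ ν β U V p G) : 0 ≤ V := by
  by_contra! hV
  have hδV : δ * V ≤ 0 := mul_nonpos_of_nonneg_of_nonpos hδ0.le hV.le
  have h1 : ∀ z, δ * V ≤ profit δ U V (p z) (G z) := fun z => by
    have h2 := hE.optimal z 0 le_rfl _ (uninformative_mem_contractions (hβ z))
      (by rw [Accepts, sub_self])
    have h3 := mul_le_mul_of_nonpos_right (cdf_le_one (uninformative (β z)) (δ * U)) hδV
    rw [profit, zero_add] at h2
    linarith
  have h4 := integral_mono (integrable_const (δ * V)) hE.integrable_principal h1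
  rw [← hE.principal_value, integral_const, probReal_univ, one_smul] at h4
  have h5 := mul_lt_mul_of_neg_right hδ1 hV
  linarith

/-- The highest profit that the principal can make after a signal with interim belief `B`, when
the agent's reservation value is `r` and her own discounted continuation value is `w`. -/
noncomputable def maxProfit (b r w : ℝ) (B : Measure ℝ) : ℝ :=
  w + incBenefit b B (r + w) - loss r B (r + w) - incBenefit b (uninformative B) r

theorem profit_le_maxProfit {a b δ U V q : ℝ} {B H : Measure ℝ} [IsProbabilityMeasure B]
    (hB : B (Icc a b)ᶜ = 0) (hat : ∀ x, B {x} = 0) (ha : a ≤ δ * U) (hV : 0 ≤ δ * V)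
    (hH : H ∈ contractions a b B) (hacc : Accepts b δ U B q H) :
    profit δ U V q H ≤ maxProfit b (δ * U) (δ * V) B := by
  have h := surplus_le hB hat ha hV hH
  rw [Accepts] at hacc
  rw [profit, maxProfit]
  linarith

/-- The contract that attains `maxProfit`, at the highest acceptable price. -/
theorem profit_poolBelow {a b δ U V : ℝ} {B : Measure ℝ} [IsProbabilityMeasure B]
    (hB : B (Icc a b)ᶜ = 0) (hat : ∀ x, B {x} = 0) (hV : 0 ≤ δ * V) :
    profit δ U V
      (incBenefit b (poolBelow (min (cutoff (δ * U) B) (δ * U + δ * V)) B) (δ * U)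
        - incBenefit b (uninformative B) (δ * U))
      (poolBelow (min (cutoff (δ * U) B) (δ * U + δ * V)) B) =
      maxProfit b (δ * U) (δ * V) B := by
  rw [profit, maxProfit, ← surplus_poolBelow hB hat hV]
  ring

theorem IsStationaryEquilibrium.profit_eq {a b δ U V : ℝ} {ν : Measure Z} {β : Kernel Z ℝ}
    [IsMarkovKernel β] {p : Z → ℝ} {G : Z → Measure ℝ} (hβ : ∀ z, β z (Icc a b)ᶜ = 0)
    (hat : ∀ z x, β z {x} = 0) (ha : a ≤ δ * U) (hV : 0 ≤ δ * V)
    (hE : IsStationaryEquilibrium a b δ ν β U V p G) (z : Z) :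
    profit δ U V (p z) (G z) = maxProfit b (δ * U) (δ * V) (β z) := by
  refine le_antisymm
    (profit_le_maxProfit (hβ z) (hat z) ha hV (hE.feasible z) (hE.accepted z)) ?_
  rw [← profit_poolBelow (hβ z) (hat z) hV]
  have hmem := poolBelow_mem_contractions (hβ z)
    (min (cutoff (δ * U) (β z)) (δ * U + δ * V))
  exact hE.optimal z _ (sub_nonneg.2 (incBenefit_uninformative_le (hβ z) hmem _)) _ hmem le_rfl

theorem integral_maxProfit {a b : ℝ} {F : Measure ℝ} [IsProbabilityMeasure F]
    (hFΘ : F (Icc a b)ᶜ = 0) {ν : Measure Z} [IsProbabilityMeasure ν]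
    {β : Kernel Z ℝ} [IsMarkovKernel β] (hβ : ∀ z, β z (Icc a b)ᶜ = 0)
    (hat : ∀ z x, β z {x} = 0) (hF : (ν ⊗ₘ β).snd = F) (r w : ℝ) :
    Integrable (fun z => maxProfit b r w (β z)) ν ∧
      ∫ z, maxProfit b r w (β z) ∂ν =
        w + incBenefit b F (r + w) - ∫ z, loss r (β z) (r + w) ∂ν
          - incBenefit b (posteriorMeanLaw ν β) r := by
  obtain ⟨h1, h2⟩ := integral_incBenefit hFΘ hβ hF (r + w)
  have h3 := integrable_loss ν hβ hat r (r + w)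
  have h4 := integrable_posPart_mean ν hβ r
  have h5 : Integrable (fun z => w + incBenefit b (β z) (r + w)) ν := (integrable_const w).add h1
  have h6 : Integrable (fun z => w + incBenefit b (β z) (r + w) - loss r (β z) (r + w)) ν :=
    h5.sub h3
  simp only [maxProfit, fun z => incBenefit_uninformative (hβ z) r]
  refine ⟨h6.sub h4, ?_⟩
  rw [integral_sub h6 h4, integral_sub h5 h3, integral_add (integrable_const w) h1, h2,
    integral_posPart_mean ν hβ]
  simp

/-- The principal's continuation value reproduces itself if and only if
`k = rbar - r - δ V` solves the equation involving `Φ`. -/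
theorem integral_maxProfit_eq_iff {a b δ : ℝ} (hδ0 : 0 < δ) (hδ1 : δ < 1)
    {F : Measure ℝ} [IsProbabilityMeasure F]
    (hFΘ : F (Icc a b)ᶜ = 0) {ν : Measure Z} [IsProbabilityMeasure ν]
    {β : Kernel Z ℝ} [IsMarkovKernel β] (hβ : ∀ z, β z (Icc a b)ᶜ = 0)
    (hat : ∀ z x, β z {x} = 0) (hF : (ν ⊗ₘ β).snd = F) {r rbar V k : ℝ}
    (hr : r = reservation δ (posteriorMeanLaw ν β)) (hrbar : rbar = reservation δ F)
    (hV : 0 ≤ V) (hk : k = rbar - r - δ * V) :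
    V = ∫ z, maxProfit b r (δ * V) (β z) ∂ν ↔ k = δ / (1 - δ) * Phi F ν β r rbar k := by
  have := isProbabilityMeasure_posteriorMeanLaw ν β
  have h1 := searchPayoff_eq hδ0 hδ1 hFΘ
  have h2 := searchPayoff_eq hδ0 hδ1 (posteriorMeanLaw_compl_Icc ν hβ)
  have h3 : rbar = δ * searchPayoff δ F := hrbar
  have h4 : r = δ * searchPayoff δ (posteriorMeanLaw ν β) := hr
  rw [← hrbar] at h1
  rw [← hr] at h2
  have hδV := mul_nonneg hδ0.le hV
  have hy : rbar - k = r + δ * V := by linarith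
  rw [(integral_maxProfit hFΘ hβ hat hF r (δ * V)).2, Phi_eq F hβ hat (by linarith), hy,
    eq_comm (a := k), div_mul_eq_mul_div, div_eq_iff (by linarith)]
  generalize incBenefit b F (r + δ * V) = x
  generalize ∫ z, loss r (β z) (r + δ * V) ∂ν = y
  -- the residual of the second equation is `δ` times the residual of the first one
  have h5 : incBenefit b F rbar = searchPayoff δ F - rbar := by linarith
  have h6 : incBenefit b (posteriorMeanLaw ν β) r =
    searchPayoff δ (posteriorMeanLaw ν β) - r := by linarith
  rw [h5, h6, hk]
  have h7 : δ * (searchPayoff δ F - rbar - x + y) - (rbar - r - δ * V) * (1 - δ) =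
      δ * (V - (δ * V + x - y - (searchPayoff δ (posteriorMeanLaw ν β) - r))) := by
    rw [h3, h4]
    ring
  constructor
  · intro h
    rw [← sub_eq_zero] at h
    rw [h, mul_zero] at h7
    exact sub_eq_zero.1 h7
  · intro h
    rw [← sub_eq_zero] at h
    rw [h] at h7
    exact sub_eq_zero.1 ((mul_eq_zero.1 h7.symm).resolve_left hδ0.ne')

/-- Any nonnegative fixed point of the principal's value equation supports an equilibrium in which
she pools the types below a cutoff. -/
theorem isStationaryEquilibrium_poolBelow {a b δ : ℝ} (hδ0 : 0 < δ) (hδ1 : δ < 1)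
    {F : Measure ℝ} [IsProbabilityMeasure F]
    (hFΘ : F (Icc a b)ᶜ = 0) {ν : Measure Z} [IsProbabilityMeasure ν]
    {β : Kernel Z ℝ} [IsMarkovKernel β] (hβ : ∀ z, β z (Icc a b)ᶜ = 0)
    (hat : ∀ z x, β z {x} = 0) (hF : (ν ⊗ₘ β).snd = F) {U V : ℝ}
    (hU : U = searchPayoff δ (posteriorMeanLaw ν β)) (ha : a ≤ δ * U) (hV0 : 0 ≤ V)
    (hV : V = ∫ z, maxProfit b (δ * U) (δ * V) (β z) ∂ν) :
    IsStationaryEquilibrium a b δ ν β U V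
      (fun z => incBenefit b (poolBelow (min (cutoff (δ * U) (β z)) (δ * U + δ * V)) (β z)) (δ * U)
        - incBenefit b (uninformative (β z)) (δ * U))
      (fun z => poolBelow (min (cutoff (δ * U) (β z)) (δ * U + δ * V)) (β z)) := by
  have := isProbabilityMeasure_posteriorMeanLaw ν β
  have hδV := mul_nonneg hδ0.le hV0
  have hmem := fun z => poolBelow_mem_contractions (hβ z)
    (min (cutoff (δ * U) (β z)) (δ * U + δ * V))
  have hagent : ∀ z, agentPayoff b δ U
      (incBenefit b (poolBelow (min (cutoff (δ * U) (β z)) (δ * U + δ * V)) (β z)) (δ * U)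
        - incBenefit b (uninformative (β z)) (δ * U))
      (poolBelow (min (cutoff (δ * U) (β z)) (δ * U + δ * V)) (β z)) =
      δ * U + incBenefit b (uninformative (β z)) (δ * U) := fun z => by
    rw [agentPayoff]
    ring
  have hprofit := fun z => profit_poolBelow (U := U) (V := V) (hβ z) (hat z) hδV
  obtain ⟨h1, h2⟩ := integral_agentPayoff ν hβ (δ * U)
  refine ⟨fun z => sub_nonneg.2 (incBenefit_uninformative_le (hβ z) (hmem z) _), hmem,
    fun z => le_rfl, fun z q _ H hH hacc => ?_, ?_, ?_, ?_, ?_⟩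
  · rw [hprofit]
    exact profit_le_maxProfit (hβ z) (hat z) ha hδV hH hacc
  · simp only [hagent]
    exact h1
  · simp only [hagent]
    have h3 := searchPayoff_eq hδ0 hδ1 (posteriorMeanLaw_compl_Icc ν hβ)
    rw [reservation, ← hU] at h3
    rwa [h2]
  · simp only [hprofit]
    exact (integral_maxProfit hFΘ hβ hat hF _ _).1
  · simp only [hprofit]
    exact hV

end PublicSignal

end PersuadedSearch

open PersuadedSearch in
theorem theorem2 {Z : Type*} [MeasurableSpace Z] (a b δ : ℝ) (hab : a < b) (hb : 0 < b)
    (hδ0 : 0 < δ) (hδ1 : δ < 1)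
    (F : Measure ℝ) [IsProbabilityMeasure F] (hFΘ : F (Icc a b)ᶜ = 0) (hFac : F ≪ volume)
    (hsearch : a < δ * mean F)
    (ξ : Kernel ℝ Z) [IsMarkovKernel ξ] (β : Kernel Z ℝ) [IsMarkovKernel β]
    (hβ : IsBayesPosterior F ξ β) (hβΘ : ∀ z, β z (Icc a b)ᶜ = 0)
    (hβatom : ∀ z x, β z {x} = 0)
    (ν : Measure Z) (hν : ν = F.bind ξ)
    (Gξ : Measure ℝ) (hGξ : Gξ = posteriorMeanLaw ν β)
    (r rbar : ℝ) (hr : r = reservation δ Gξ) (hrbar : rbar = reservation δ F) :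
    (∃ (U V : ℝ) (p : Z → ℝ) (G : Z → Measure ℝ),
      IsStationaryEquilibrium a b δ ν β U V p G) ∧
    ∃ k ∈ Icc 0 (rbar - r),
      k = δ / (1 - δ) * Phi F ν β r rbar k ∧
      (∀ k' : ℝ, 0 ≤ k' → k' = δ / (1 - δ) * Phi F ν β r rbar k' → k' = k) ∧
      ∀ (U V : ℝ) (p : Z → ℝ) (G : Z → Measure ℝ),
        IsStationaryEquilibrium a b δ ν β U V p G →
          U = searchPayoff δ Gξ ∧
          V = searchPayoff δ F - searchPayoff δ Gξ - k / δ := by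
  subst hν hGξ
  have hF := hβ.snd_eq
  have := isProbabilityMeasure_posteriorMeanLaw (F.bind ξ) β
  have hG := posteriorMeanLaw_compl_Icc (F.bind ξ) hβΘ
  have hrU : δ * searchPayoff δ (posteriorMeanLaw (F.bind ξ) β) = r := hr.symm
  have hrF : δ * searchPayoff δ F = rbar := hrbar.symm
  have hle := mul_le_mul_of_nonneg_left
    (searchPayoff_posteriorMeanLaw_le hδ0 hδ1 hFΘ hβΘ hF) hδ0.le
  rw [hrU, hrF] at hle
  have har : a ≤ r := by
    have h := mul_le_mul_of_nonneg_left (mean_le_searchPayoff hδ0 hδ1 hG) hδ0.le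
    rw [mean_posteriorMeanLaw hFΘ hF, hrU] at h
    linarith
  have hc : 0 ≤ δ / (1 - δ) := div_nonneg hδ0.le (by linarith)
  obtain ⟨k, hk, hkeq⟩ := exists_eq_mul_Phi (ν := F.bind ξ) F hβΘ hβatom hle hc
  have hval : ∀ V, k = rbar - r - δ * V →
      V = searchPayoff δ F - searchPayoff δ (posteriorMeanLaw (F.bind ξ) β) - k / δ := by
    intro V hV
    rw [hV, ← hrF, ← hrU]
    field_simp
    ring
  refine ⟨?_, k, hk, hkeq,
    fun k' _ hk' => eq_of_eq_mul_Phi F hβΘ hβatom hle hc hk' hkeq, fun U V p G hE => ?_⟩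
  · have hV0 : 0 ≤ (rbar - r - k) / δ := div_nonneg (by linarith [hk.2]) hδ0.le
    have hkV : k = rbar - r - δ * ((rbar - r - k) / δ) := by
      rw [mul_div_cancel₀ _ hδ0.ne']
      ring
    refine ⟨_, (rbar - r - k) / δ, _, _, isStationaryEquilibrium_poolBelow hδ0 hδ1 hFΘ hβΘ
      hβatom hF rfl (hrU ▸ har) hV0 ?_⟩
    rw [hrU]
    exact (integral_maxProfit_eq_iff hδ0 hδ1 hFΘ hβΘ hβatom hF hr hrbar hV0 hkV).2 hkeq
  · have hU := hE.agent_value_eq hδ0 hδ1 hβΘ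
    have hV0 := hE.principal_value_nonneg hδ0 hδ1 hβΘ
    have hrU' : δ * U = r := by rw [hU, hrU]
    have hV := hE.principal_value
    simp only [hE.profit_eq hβΘ hβatom (hrU' ▸ har) (mul_nonneg hδ0.le hV0), hrU'] at hV
    have hk' := (integral_maxProfit_eq_iff hδ0 hδ1 hFΘ hβΘ hβatom hF hr hrbar hV0 rfl).1 hV
    exact ⟨hU, hval V (eq_of_eq_mul_Phi F hβΘ hβatom hle hc hkeq hk')⟩
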